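/- **Notation.** Let $\Omega=\{0,1\}^{\mathbb N}$ be the set of infinite strings $\omega_0\omega_1\omega_2\cdots$, with the lexicographic order $\preceq$ and the shift $S(\omega_0\omega_1\omega_2\cdots)=\omega_1\omega_2\cdots$. Let $\Omega^\bullet$ be the set of decimals $\omega_0\cdots\omega_N\bullet\omega_{N+1}\omega_{N+2}\cdots$ ($N\ge -1$), where decimals that differ only by zeros at the far left are identified. Decimals are ordered lexicographically after padding with leading zeros so that the points are aligned. For $\Gamma\subseteq\Omega^\bullet$ let $\widehat\Gamma\subseteq\Omega$ be the set of strings obtained by removing the point from the decimals in $\Gamma$ (written with any number of leading zeros before the point); for $\Gamma\subseteq\Omega$ let $\Gamma^\bullet\subseteq\Omega^\bullet$ be the set of decimals obtained from strings in $\Gamma$ by placing the point anywhere (also to the left of the string, filling in zeros: $\bullet 0\cdots0\,\omega_0\omega_1\cdots$). A set $\Gamma\subseteq\Omega^\bullet$ is *shift invariant* if $[S^n(\widehat\Gamma)]^\bullet=\Gamma$ for all $n\ge0$. A *binary radix system* is a triple $(\Gamma,\pi,B)$ with $B>1$ real, $\Gamma\subseteq\Omega^\bullet$ shift invariant, and $\pi:\Gamma\to[0,\infty)$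 bijective and strictly increasing, such that $$\pi(\omega_0\cdots\omega_N\bullet\omega_{N+1}\cdots)=\sum_{n=-\infty}^{N}\omega_{N-n}B^n$$ on $\Gamma$. A pair $(\alpha,\beta)\in\Omega^2$ is *admissible* if $\alpha_0\alpha_1=01$, $\beta_0\beta_1=10$, and $S^n\alpha\notin(\alpha,\beta]$, $S^n\beta\notin[\alpha,\beta)$ for all $n\ge0$. Put $$\Omega_{(\alpha,\beta,-)}=\{\omega: S^n\omega\notin(\alpha,\beta]\ \forall n\ge0\},\qquad \Omega_{(\alpha,\beta,+)}=\{\omega: S^n\omega\notin[\alpha,\beta)\ \forall n\ge0\},$$ $$\Omega^0_{(\alpha,\beta,-)}=\{\omega\in\Omega_{(\alpha,\beta,-)}:0\omega\preceq\alpha\},\qquad \Omega^0_{(\alpha,\beta,+)}=\{\omega\in\Omega_{(\alpha,\beta,+)}:0\omega\prec\alpha\},$$ and $\Omega^\bullet_{(\alpha,\beta,\pm)}=[\Omega^0_{(\alpha,\beta,\pm)}]^\bullet$. The pair is *null* if $\limsup_{n\to\infty}\frac1n\ln|\Gamma_n|=0$, where $\Gamma_n$ is the set of initial segments of length $n$ of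 strings in $\Omega_{(\alpha,\beta,-)}\cup\Omega_{(\alpha,\beta,+)}$. If $b$ is the least solution in $[\frac12,1)$ of $\sum_{n\ge0}\alpha_nx^n=\sum_{n\ge0}\beta_nx^n$ and $B_{(\alpha,\beta)}=1/b$, then $R(\alpha,\beta,\pm)$ denotes the triple $(\Omega^\bullet_{(\alpha,\beta,\pm)},\pi_{(\alpha,\beta)},B_{(\alpha,\beta)})$ with $$\pi_{(\alpha,\beta)}(\omega_0\cdots\omega_N\bullet\omega_{N+1}\cdots)=\sum_{n=-\infty}^{N}\omega_{N-n}B_{(\alpha,\beta)}^n.$$ **Theorem.** Let $(\Gamma,\pi,B)$ be a binary radix system. Then the pair $$\alpha=\sup\{\gamma\in\widehat\Gamma:\gamma_0=0\},\qquad \beta=\inf\{\gamma\in\widehat\Gamma:\gamma_0=1\}$$ (supremum and infimum in the lexicographic order) exists, is admissible and is not null, the equation $\sum_{n\ge0}\alpha_nx^n=\sum_{n\ge0}\beta_nx^n$ has a least solution in $[\frac12,1)$, and $R(\alpha,\beta,-)=(\Gamma,\pi,B)$ or $R(\alpha,\beta,+)=(\Gamma,\pi,B)$. -/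

import Mathlib

open scoped NNReal

noncomputable section

namespace BinaryRadix

/-- Infinite strings `ω₀ ω₁ ω₂ ⋯` of zeros and ones, with the lexicographic order. -/
abbrev Str : Type := Lex (ℕ → Fin 2)

/-- The `n`-th entry of a string. -/
def Str.digit (ω : Str) (n : ℕ) : Fin 2 := ofLex ω n

/-- The shift operator `S (ω₀ ω₁ ω₂ ⋯) = ω₁ ω₂ ⋯`. -/
def shift (ω : Str) : Str := toLex fun n => ω.digit (n + 1)

/-- The string `0 ω₀ ω₁ ω₂ ⋯`. -/
def consZero (ω : Str) : Str := toLex fun n => if n = 0 then 0 else ω.digit (n - 1)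

/-- Decimals `ω₀ ⋯ ω_N • ω_{N+1} ω_{N+2} ⋯`, two of them being identified if they differ only in
zeros at the far left. Such a decimal is given by its digits indexed by position: `digit n` is
the digit that goes with the power `Bⁿ`, and it vanishes for all large `n`. -/
@[ext]
structure Decimal where
  digit : ℤ → Fin 2
  eventually_zero : ∃ N : ℤ, ∀ n : ℤ, N < n → digit n = 0

/-- The decimal `ω₀ ⋯ ω_N • ω_{N+1} ⋯`: the entry `ω_k` stands at position `N - k`. For `N = -1`
this is `• ω₀ ω₁ ⋯`, for `N = -2` it is `• 0 ω₀ ω₁ ⋯`, and so on. -/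
def place (ω : Str) (N : ℤ) : Decimal where
  digit n := if n ≤ N then ω.digit (N - n).toNat else 0
  eventually_zero := ⟨N, fun n hn => by simp [not_le.mpr hn]⟩

/-- `Γ^•`: all decimals obtained from strings in `Γ` by placing the point anywhere. -/
def dot (Γ : Set Str) : Set Decimal := {d | ∃ ω ∈ Γ, ∃ N : ℤ, d = place ω N}

/-- `Γ̂`: all strings obtained from decimals in `Γ` by removing the point. A decimal may be written
with any number of leading zeros before the point, and with nothing before the point if its
integer part is zero (`N = -1`). -/
def hat (Γ : Set Decimal) : Set Str := {ω | ∃ N : ℤ, -1 ≤ N ∧ place ω N ∈ Γ}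

/-- Shift invariance of a set of decimals: `[Sⁿ(Γ̂)]^• = Γ` for all `n ≥ 0`. -/
def ShiftInvariant (Γ : Set Decimal) : Prop := ∀ n : ℕ, dot (shift^[n] '' hat Γ) = Γ

/-- The order on decimals: pad with leading zeros so that the points are aligned, and compare
the resulting strings lexicographically. -/
instance : LT Decimal :=
  ⟨fun d e => ∃ (u v : Str) (N : ℤ), -1 ≤ N ∧ d = place u N ∧ e = place v N ∧ u < v⟩

/-- The sum `∑ dₙ Bⁿ` over all integers `n`; it converges for every decimal if `B > 1`. -/
def Decimal.value (B : ℝ) (d : Decimal) : ℝ := ∑' n : ℤ, ((d.digit n : ℕ) : ℝ) * B ^ n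

/-- A triple `(Γ, π, B)` of a set of decimals, a map from it to the non-negative reals, and a
real number. -/
structure RadixTriple where
  space : Set Decimal
  radixMap : space → ℝ≥0
  base : ℝ

/-- Binary radix systems. -/
structure RadixTriple.IsBinaryRadixSystem (T : RadixTriple) : Prop where
  one_lt_base : 1 < T.base
  shiftInvariant : ShiftInvariant T.space
  bijective : Function.Bijective T.radixMap
  strictlyIncreasing : ∀ d e : T.space, (d : Decimal) < (e : Decimal) →
    T.radixMap d < T.radixMap e
  radixMap_eq : ∀ d : T.space, (T.radixMap d : ℝ) = (d : Decimal).value T.base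

/-- Admissible pairs of strings. -/
structure Admissible (α β : Str) : Prop where
  α_zero : α.digit 0 = 0
  α_one : α.digit 1 = 1
  β_zero : β.digit 0 = 1
  β_one : β.digit 1 = 0
  shift_α : ∀ n : ℕ, shift^[n] α ∉ Set.Ioc α β
  shift_β : ∀ n : ℕ, shift^[n] β ∉ Set.Ico α β

/-- `Ω_(α,β,-)`. -/
def spaceMinus (α β : Str) : Set Str := {ω | ∀ n : ℕ, shift^[n] ω ∉ Set.Ioc α β}

/-- `Ω_(α,β,+)`. -/
def spacePlus (α β : Str) : Set Str := {ω | ∀ n : ℕ, shift^[n] ω ∉ Set.Ico α β}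

/-- `Ω⁰_(α,β,-)`. -/
def spaceMinusZero (α β : Str) : Set Str := {ω ∈ spaceMinus α β | consZero ω ≤ α}

/-- `Ω⁰_(α,β,+)`. -/
def spacePlusZero (α β : Str) : Set Str := {ω ∈ spacePlus α β | consZero ω < α}

/-- `Γₙ`: the initial segments `ω₀ ⋯ ω_{n-1}` of strings in `Γ`. -/
def initialSegments (Γ : Set Str) (n : ℕ) : Set (Fin n → Fin 2) :=
  (fun (ω : Str) (i : Fin n) => ω.digit i) '' Γ

/-- The exponential growth rate `h(Γ) = limsup (1/n) ln |Γₙ|`; the sequence takes values in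
`[0, ln 2]`. -/
def growthRate (Γ : Set Str) : ℝ :=
  Filter.limsup (fun n : ℕ => (1 / (n : ℝ)) * Real.log ((initialSegments Γ n).ncard : ℝ))
    Filter.atTop

/-- Null pairs: `h(Ω_(α,β)) = 0`, where `Ω_(α,β) = Ω_(α,β,-) ∪ Ω_(α,β,+)`. -/
def Null (α β : Str) : Prop := growthRate (spaceMinus α β ∪ spacePlus α β) = 0

/-- The solutions in `[1/2, 1)` of `∑ αₙ xⁿ = ∑ βₙ xⁿ`. -/
def solutions (α β : Str) : Set ℝ :=
  {x | x ∈ Set.Ico (1 / 2 : ℝ) 1 ∧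
    ∑' n : ℕ, ((α.digit n : ℕ) : ℝ) * x ^ n = ∑' n : ℕ, ((β.digit n : ℕ) : ℝ) * x ^ n}

/-- The number `b`, the minimum of `solutions α β` (whenever this set is nonempty). -/
def leastSolution (α β : Str) : ℝ := sInf (solutions α β)

/-- The base `B_(α,β) = 1 / b`. -/
def baseOf (α β : Str) : ℝ := 1 / leastSolution α β

/-- The triple `R(α,β,-) = (Ω^•_(α,β,-), π_(α,β), B_(α,β))`. -/
def RMinus (α β : Str) : RadixTriple where
  space := dot (spaceMinusZero α β)
  radixMap d := ((d : Decimal).value (baseOf α β)).toNNReal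
  base := baseOf α β

/-- The triple `R(α,β,+) = (Ω^•_(α,β,+), π_(α,β), B_(α,β))`. -/
def RPlus (α β : Str) : RadixTriple where
  space := dot (spacePlusZero α β)
  radixMap d := ((d : Decimal).value (baseOf α β)).toNNReal
  base := baseOf α β

end BinaryRadix

end

namespace BinaryRadix

/-! Put `b = 1/B` and let `M` be the supremum of the values `ev b ω` over the strings of Γ̂.
Surjectivity of π and shift invariance make these values fill `[0, M)`. Monotonicity then ties the
leading digit to the value: 0 below `b * M`, 1 above. So every string of Γ̂ is the itinerary of its
value under `y ↦ y / b`, `y ↦ (y - 1) / b` with switching point `b * M`. The tie at `b * M` is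
resolved by 0 if `M` is attained and by 1 if not (`hat_eq_left`, `hat_eq_right`). The strings α and
β are the two itineraries of the switching point.

The itineraries are recovered from α and β alone (`spaceMinusZero_eq`, `spacePlusZero_eq`): any
string lies between the two itineraries of one point, and if these differ, their tails from the
first difference on are α and β.

Both α and β have value `b * M` at `b`. If they also agreed at some `x < b`, evaluating at `x` the
itinerary of `y` would give a function of `y` with Hölder exponent `log_b x > 1`, hence a constant;
but it is 0 at 0 and at least 1 at `M` (`ev_ne_of_lt`). The pair is not null, since points at
distance of order `bⁿ` have different prefixes of length `n`. -/

/-! ### Lexicographic order, shift and prefixes. -/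

theorem Str.ext {u v : Str} (h : ∀ n, u.digit n = v.digit n) : u = v :=
  ofLex.injective (funext h)

theorem Str.lt_iff {u v : Str} :
    u < v ↔ ∃ n, (∀ k < n, u.digit k = v.digit k) ∧ u.digit n = 0 ∧ v.digit n = 1 := by
  have h2 : ∀ a b : Fin 2, a < b ↔ a = 0 ∧ b = 1 := by decide
  constructor
  · rintro ⟨n, h, h'⟩
    exact ⟨n, h, (h2 _ _).1 h'⟩
  · rintro ⟨n, h, h'⟩
    exact ⟨n, h, (h2 _ _).2 h'⟩

theorem fin_two_ne_one {a : Fin 2} : ¬ a = 1 ↔ a = 0 := by revert a; decide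

theorem fin_two_ne_zero {a : Fin 2} : ¬ a = 0 ↔ a = 1 := by revert a; decide

theorem Str.lt_of_digit_zero {u v : Str} (hu : u.digit 0 = 0) (hv : v.digit 0 = 1) : u < v :=
  Str.lt_iff.2 ⟨0, by simp, hu, hv⟩

@[simp] theorem digit_shift (ω : Str) (n : ℕ) : (shift ω).digit n = ω.digit (n + 1) := rfl

@[simp] theorem digit_shift_iterate (ω : Str) (m n : ℕ) :
    (shift^[m] ω).digit n = ω.digit (n + m) := by
  induction m generalizing ω with
  | zero => rfl
  | succ m ih => rw [Function.iterate_succ_apply, ih]; simp [add_assoc]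

@[simp] theorem digit_consZero_zero (ω : Str) : (consZero ω).digit 0 = 0 := rfl

@[simp] theorem digit_consZero_succ (ω : Str) (n : ℕ) :
    (consZero ω).digit (n + 1) = ω.digit n := by
  simp [consZero, Str.digit]

@[simp] theorem shift_consZero (ω : Str) : shift (consZero ω) = ω := Str.ext fun n => by simp

theorem consZero_shift {ω : Str} (h : ω.digit 0 = 0) : consZero (shift ω) = ω :=
  Str.ext fun n => by cases n <;> simp [h]

theorem Str.shift_lt_shift {u v : Str} (h : u.digit 0 = v.digit 0) : shift u < shift v ↔ u < v := by
  rw [Str.lt_iff, Str.lt_iff]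
  constructor
  · rintro ⟨n, h1, h2, h3⟩
    refine ⟨n + 1, fun k hk => ?_, h2, h3⟩
    cases k with
    | zero => exact h
    | succ k => exact h1 k (by omega)
  · rintro ⟨n, h1, h2, h3⟩
    cases n with
    | zero => rw [h, h3] at h2; exact absurd h2 (by decide)
    | succ n => exact ⟨n, fun k hk => h1 (k + 1) (by omega), h2, h3⟩

theorem consZero_lt_consZero {u v : Str} : consZero u < consZero v ↔ u < v := by
  rw [← Str.shift_lt_shift (by simp)]; simp

theorem consZero_le_consZero {u v : Str} : consZero u ≤ consZero v ↔ u ≤ v :=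
  not_lt.symm.trans ((not_congr consZero_lt_consZero).trans not_lt)

/-- The zero string. -/
def zeroStr : Str := toLex fun _ => 0

@[simp] theorem digit_zeroStr (n : ℕ) : zeroStr.digit n = 0 := rfl

theorem zeroStr_le (ω : Str) : zeroStr ≤ ω := by
  by_contra h
  obtain ⟨n, -, -, h⟩ := Str.lt_iff.1 (not_le.1 h)
  exact absurd h (by simp)

/-- Strings between two strings with a common prefix have the same prefix. -/
theorem Str.digit_eq_of_mem_Icc {u v w : Str} {n : ℕ} (huw : u ≤ w) (hwv : w ≤ v)
    (h : ∀ k < n, u.digit k = v.digit k) : ∀ k < n, w.digit k = u.digit k := by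
  intro k
  induction k using Nat.strong_induction_on with
  | _ k ih =>
    intro hk
    by_contra hne
    by_cases h0 : u.digit k = 0
    · rw [h0] at hne
      have : v < w := Str.lt_iff.2 ⟨k, fun j hj => by
        rw [ih j hj (hj.trans hk), h j (hj.trans hk)], by rw [← h k hk, h0], fin_two_ne_zero.1 hne⟩
      exact absurd hwv (not_le.2 this)
    · rw [fin_two_ne_zero] at h0
      rw [h0, fin_two_ne_one] at hne
      have : w < u := Str.lt_iff.2 ⟨k, fun j hj => ih j hj (hj.trans hk), hne, h0⟩
      exact absurd huw (not_le.2 this)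

theorem Str.shift_iterate_le {u v : Str} {n : ℕ} (h : ∀ k < n, u.digit k = v.digit k)
    (huv : u ≤ v) : shift^[n] u ≤ shift^[n] v := by
  by_contra hlt
  obtain ⟨m, h1, h2, h3⟩ := Str.lt_iff.1 (not_le.1 hlt)
  refine absurd huv (not_le.2 (Str.lt_iff.2 ⟨m + n, fun k hk => ?_, by simpa using h2,
    by simpa using h3⟩))
  rcases lt_or_ge k n with hkn | hkn
  · exact (h k hkn).symm
  · have := h1 (k - n) (by omega)
    simpa [Nat.sub_add_cancel hkn] using this

theorem Str.eq_of_shift_iterate_eq {u v : Str} {n : ℕ} (h : ∀ k < n, u.digit k = v.digit k)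
    (huv : shift^[n] u = shift^[n] v) : u = v := by
  refine Str.ext fun k => ?_
  rcases lt_or_ge k n with hkn | hkn
  · exact h k hkn
  · have := congrArg (fun w => Str.digit w (k - n)) huv
    simpa [Nat.sub_add_cancel hkn] using this

/-- A strict inequality between strings is decided by finitely many digits. -/
theorem Str.exists_prefix_lt {u v : Str} (h : u < v) :
    ∃ n, ∀ w : Str, (∀ k < n, w.digit k = v.digit k) → u < w := by
  obtain ⟨n, h1, h2, h3⟩ := Str.lt_iff.1 h
  exact ⟨n + 1, fun w hw => Str.lt_iff.2 ⟨n, fun k hk => by rw [h1 k hk, hw k (by omega)], h2,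
    by rw [hw n (by omega), h3]⟩⟩

theorem Str.exists_prefix_gt {u v : Str} (h : u < v) :
    ∃ n, ∀ w : Str, (∀ k < n, w.digit k = u.digit k) → w < v := by
  obtain ⟨n, h1, h2, h3⟩ := Str.lt_iff.1 h
  exact ⟨n + 1, fun w hw => Str.lt_iff.2 ⟨n, fun k hk => by rw [← h1 k hk, hw k (by omega)],
    by rw [hw n (by omega), h2], h3⟩⟩

/-! ### Values of strings. -/

/-- The value `∑ ωₙ xⁿ` of a string at `x`. -/
noncomputable def ev (x : ℝ) (ω : Str) : ℝ := ∑' n : ℕ, ((ω.digit n : ℕ) : ℝ) * x ^ n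

theorem digit_cast_le_one (a : Fin 2) : ((a : ℕ) : ℝ) ≤ 1 := by
  exact_mod_cast Nat.lt_succ_iff.1 a.2

theorem ev_nonneg {x : ℝ} (hx0 : 0 < x) (ω : Str) : 0 ≤ ev x ω :=
  tsum_nonneg fun n => by positivity

section ev

variable {x : ℝ} (hx0 : 0 < x) (hx1 : x < 1)

include hx0 hx1

theorem summable_ev (ω : Str) : Summable fun n : ℕ => ((ω.digit n : ℕ) : ℝ) * x ^ n :=
  Summable.of_nonneg_of_le (fun n => by positivity)
    (fun n => mul_le_of_le_one_left (by positivity) (digit_cast_le_one _))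
    (summable_geometric_of_lt_one hx0.le hx1)

theorem ev_le (ω : Str) : ev x ω ≤ (1 - x)⁻¹ := by
  rw [← tsum_geometric_of_lt_one hx0.le hx1]
  exact Summable.tsum_le_tsum
    (fun n => mul_le_of_le_one_left (by positivity) (digit_cast_le_one _))
    (summable_ev hx0 hx1 ω) (summable_geometric_of_lt_one hx0.le hx1)

theorem ev_eq (ω : Str) : ev x ω = (ω.digit 0 : ℕ) + x * ev x (shift ω) := by
  rw [ev, (summable_ev hx0 hx1 ω).tsum_eq_zero_add, ev, ← tsum_mul_left]
  simp only [pow_zero, mul_one, digit_shift]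
  congr 2
  ext n
  ring

theorem ev_eq_of_zero {ω : Str} (h : ω.digit 0 = 0) : ev x ω = x * ev x (shift ω) := by
  rw [ev_eq hx0 hx1, h]; simp

theorem ev_eq_of_one {ω : Str} (h : ω.digit 0 = 1) : ev x ω = 1 + x * ev x (shift ω) := by
  rw [ev_eq hx0 hx1, h]; simp

theorem ev_consZero (ω : Str) : ev x (consZero ω) = x * ev x ω := by
  rw [ev_eq_of_zero hx0 hx1 rfl, shift_consZero]

theorem ev_sub_eq {u v : Str} {n : ℕ} (h : ∀ k < n, u.digit k = v.digit k) :
    ev x v - ev x u = x ^ n * (ev x (shift^[n] v) - ev x (shift^[n] u)) := by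
  induction n generalizing u v with
  | zero => simp
  | succ n ih =>
    rw [ev_eq hx0 hx1 u, ev_eq hx0 hx1 v, h 0 (by omega)]
    have := @ih (shift u) (shift v) (fun k hk => h (k + 1) (by omega))
    rw [Function.iterate_succ_apply, Function.iterate_succ_apply]
    linear_combination x * this

theorem abs_ev_sub_le (u v : Str) : |ev x v - ev x u| ≤ (1 - x)⁻¹ := by
  have h1 := ev_nonneg hx0 u
  have h2 := ev_nonneg hx0 v
  have h3 := ev_le hx0 hx1 u
  have h4 := ev_le hx0 hx1 v
  rw [abs_le]; constructor <;> linarith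

end ev

@[simp] theorem ev_zeroStr (x : ℝ) : ev x zeroStr = 0 := by simp [ev]

/-! ### Itineraries of the two-branch map. -/

/-- The parameters of the maps `y ↦ y / b`, `y ↦ (y - 1) / b` with switching point `b * M`
that send the interval `[0, M]` to itself. -/
structure Params (b M : ℝ) : Prop where
  pos : 0 < b
  lt_one : b < 1
  one_le : 1 ≤ b * M
  le : M ≤ 1 + b * M

/-- Strings that are itineraries of points of `[0, M]`, with either choice of the digit whenever
an orbit hits the switching point. -/
def Compat (b M : ℝ) (ω : Str) : Prop :=
  ∀ n, (ω.digit n = 0 → ev b (shift^[n] ω) ≤ b * M) ∧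
    (ω.digit n = 1 → b * M ≤ ev b (shift^[n] ω)) ∧ ev b (shift^[n] ω) ≤ M

/-- Itineraries with the digit `0` at the switching point. -/
def LeftItin (b M : ℝ) (ω : Str) : Prop :=
  ∀ n, (ω.digit n = 1 ↔ b * M < ev b (shift^[n] ω)) ∧ ev b (shift^[n] ω) ≤ M

/-- Itineraries of points of `[0, M)` with the digit `1` at the switching point. -/
def RightItin (b M : ℝ) (ω : Str) : Prop :=
  ∀ n, (ω.digit n = 1 ↔ b * M ≤ ev b (shift^[n] ω)) ∧ ev b (shift^[n] ω) < M

section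

variable {b M : ℝ}

theorem Params.M_pos (h : Params b M) : 0 < M := by
  have := h.one_le
  exact pos_of_mul_pos_right (by linarith) h.pos.le

theorem Params.switch_lt (h : Params b M) : b * M < M := by
  have := h.M_pos
  have := h.lt_one
  nlinarith

theorem Params.half_le (h : Params b M) : 1 / 2 ≤ b := by
  have h1 := h.one_le
  have h2 := h.le
  have h3 := h.lt_one
  have h4 := h.pos
  nlinarith

theorem LeftItin.compat {ω : Str} (h : LeftItin b M ω) : Compat b M ω := fun n =>
  ⟨fun h0 => not_lt.1 fun hl => by rw [(h n).1.2 hl] at h0; exact absurd h0 (by decide),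
    fun h1 => ((h n).1.1 h1).le, (h n).2⟩

theorem RightItin.compat {ω : Str} (h : RightItin b M ω) : Compat b M ω := fun n =>
  ⟨fun h0 => le_of_not_ge fun hl => by rw [(h n).1.2 hl] at h0; exact absurd h0 (by decide),
    fun h1 => (h n).1.1 h1, (h n).2.le⟩

theorem Compat.shift_iterate {ω : Str} (h : Compat b M ω) (m : ℕ) :
    Compat b M (shift^[m] ω) := fun n => by
  rw [← Function.iterate_add_apply, digit_shift_iterate]; exact h (n + m)

theorem LeftItin.shift_iterate {ω : Str} (h : LeftItin b M ω) (m : ℕ) :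
    LeftItin b M (shift^[m] ω) := fun n => by
  rw [← Function.iterate_add_apply, digit_shift_iterate]; exact h (n + m)

theorem RightItin.shift_iterate {ω : Str} (h : RightItin b M ω) (m : ℕ) :
    RightItin b M (shift^[m] ω) := fun n => by
  rw [← Function.iterate_add_apply, digit_shift_iterate]; exact h (n + m)

theorem Compat.ev_le_of_zero {ω : Str} (h : Compat b M ω) (h0 : ω.digit 0 = 0) :
    ev b ω ≤ b * M := (h 0).1 h0

theorem Compat.le_ev_of_one {ω : Str} (h : Compat b M ω) (h1 : ω.digit 0 = 1) :
    b * M ≤ ev b ω := (h 0).2.1 h1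

theorem Compat.ev_le {ω : Str} (h : Compat b M ω) : ev b ω ≤ M := (h 0).2.2

theorem LeftItin.one_iff {ω : Str} (h : LeftItin b M ω) : ω.digit 0 = 1 ↔ b * M < ev b ω :=
  (h 0).1

theorem RightItin.one_iff {ω : Str} (h : RightItin b M ω) : ω.digit 0 = 1 ↔ b * M ≤ ev b ω :=
  (h 0).1

theorem LeftItin.zero_iff {ω : Str} (h : LeftItin b M ω) : ω.digit 0 = 0 ↔ ev b ω ≤ b * M := by
  rw [← fin_two_ne_one, h.one_iff, not_lt]

theorem RightItin.zero_iff {ω : Str} (h : RightItin b M ω) :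
    ω.digit 0 = 0 ↔ ev b ω < b * M := by
  rw [← fin_two_ne_one, h.one_iff, not_le]

theorem RightItin.ev_lt {ω : Str} (h : RightItin b M ω) : ev b ω < M := (h 0).2

variable (hp : Params b M)

include hp

/-- At the first differing digit the tails lie on opposite sides of the switching point, and the
common prefix cancels. -/
theorem Params.ev_le_ev {u v : Str} (hu : Compat b M u) (hv : Compat b M v) (h : u ≤ v) :
    ev b u ≤ ev b v := by
  rcases h.eq_or_lt with rfl | h
  · rfl
  obtain ⟨n, h1, h2, h3⟩ := Str.lt_iff.1 h
  have := ev_sub_eq hp.pos hp.lt_one h1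
  have h4 := (hu n).1 h2
  have h5 := (hv n).2.1 h3
  have : 0 ≤ b ^ n * (ev b (shift^[n] v) - ev b (shift^[n] u)) :=
    mul_nonneg (pow_pos hp.pos n).le (by linarith)
  linarith

theorem Params.lt_of_ev_lt {u v : Str} (hu : Compat b M u) (hv : Compat b M v)
    (h : ev b u < ev b v) : u < v :=
  not_le.1 fun hle => absurd (hp.ev_le_ev hv hu hle) (not_le.2 h)

/-- Strictness comes from `v` alone: a digit 1 in a left itinerary puts its tail strictly above the
switching point. So `u` may be of either kind. -/
theorem Params.left_strictMono {u v : Str} (hu : Compat b M u) (hv : LeftItin b M v) (h : u < v) :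
    ev b u < ev b v := by
  obtain ⟨n, h1, h2, h3⟩ := Str.lt_iff.1 h
  have := ev_sub_eq hp.pos hp.lt_one h1
  have h4 := (hu n).1 h2
  have h5 := (hv n).1.1 h3
  have : 0 < b ^ n * (ev b (shift^[n] v) - ev b (shift^[n] u)) :=
    mul_pos (pow_pos hp.pos n) (by linarith)
  linarith

theorem Params.right_strictMono {u v : Str} (hu : RightItin b M u) (hv : Compat b M v)
    (h : u < v) : ev b u < ev b v := by
  obtain ⟨n, h1, h2, h3⟩ := Str.lt_iff.1 h
  have := ev_sub_eq hp.pos hp.lt_one h1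
  have h4 : ev b (shift^[n] u) < b * M := by
    rw [← (hu.shift_iterate n).zero_iff]; simpa using h2
  have h5 := (hv n).2.1 h3
  have : 0 < b ^ n * (ev b (shift^[n] v) - ev b (shift^[n] u)) :=
    mul_pos (pow_pos hp.pos n) (by linarith)
  linarith

theorem Params.left_injective {u v : Str} (hu : LeftItin b M u) (hv : LeftItin b M v)
    (h : ev b u = ev b v) : u = v := by
  rcases lt_trichotomy u v with h' | h' | h'
  · exact absurd (hp.left_strictMono hu.compat hv h') h.not_lt
  · exact h'
  · exact absurd (hp.left_strictMono hv.compat hu h') h.symm.not_lt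

theorem Params.right_injective {u v : Str} (hu : RightItin b M u) (hv : RightItin b M v)
    (h : ev b u = ev b v) : u = v := by
  rcases lt_trichotomy u v with h' | h' | h'
  · exact absurd (hp.right_strictMono hu hv.compat h') h.not_lt
  · exact h'
  · exact absurd (hp.right_strictMono hv hu.compat h') h.symm.not_lt

/-- The string of digits `d` read off along the orbits of `y ↦ (y - d y) / b` represents the
starting point. -/
theorem Params.exists_orbit_string (d : ℝ → Fin 2) (I : Set ℝ) (hI : I ⊆ Set.Icc 0 M)
    (hd : ∀ y ∈ I, (y - (d y : ℕ)) / b ∈ I) {y : ℝ} (hy : y ∈ I) :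
    ∃ ω : Str, ev b ω = y ∧
      ∀ n, ω.digit n = d (ev b (shift^[n] ω)) ∧ ev b (shift^[n] ω) ∈ I := by
  set t : ℝ → ℝ := fun y => (y - (d y : ℕ)) / b with ht
  have hmem : ∀ y ∈ I, ∀ n, t^[n] y ∈ I := by
    intro y hy n
    induction n with
    | zero => exact hy
    | succ n ih => rw [Function.iterate_succ_apply']; exact hd _ ih
  let s : ℝ → Str := fun y => toLex fun n => d (t^[n] y)
  have hs : ∀ y n, (s y).digit n = d (t^[n] y) := fun y n => rfl
  have hev : ∀ y ∈ I, ev b (s y) = y := by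
    intro y hy
    -- The partial sums telescope, and the remainder vanishes because the orbit stays in `[0, M]`.
    have hsum : ∀ n, ∑ k ∈ Finset.range n, (((s y).digit k : ℕ) : ℝ) * b ^ k
        = y - b ^ n * t^[n] y := by
      intro n
      induction n with
      | zero => simp
      | succ n ih =>
        rw [Finset.sum_range_succ, ih, Function.iterate_succ_apply', hs]
        simp only [ht]
        have := hp.pos.ne'
        field_simp
        ring
    have hlim : Filter.Tendsto (fun n => y - b ^ n * t^[n] y) Filter.atTop (nhds (y - 0)) := by
      refine tendsto_const_nhds.sub ?_
      refine squeeze_zero (g := fun n => b ^ n * M)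
        (fun n => mul_nonneg (pow_pos hp.pos n).le (hI (hmem y hy n)).1)
        (fun n => mul_le_mul_of_nonneg_left (hI (hmem y hy n)).2 (pow_pos hp.pos n).le) ?_
      simpa using (tendsto_pow_atTop_nhds_zero_of_lt_one hp.pos.le hp.lt_one).mul_const M
    have h1 := (summable_ev hp.pos hp.lt_one (s y)).hasSum.tendsto_sum_nat
    simp only [hsum] at h1
    simpa [ev] using tendsto_nhds_unique h1 hlim
  have hshift : ∀ n y, shift^[n] (s y) = s (t^[n] y) := by
    intro n y
    refine Str.ext fun k => ?_
    rw [digit_shift_iterate, hs, hs, Function.iterate_add_apply]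
  refine ⟨s y, hev y hy, fun n => ?_⟩
  rw [hshift, hev _ (hmem y hy n)]
  exact ⟨rfl, hmem y hy n⟩

theorem Params.div_mem_Icc {y : ℝ} (h0 : 0 ≤ y) (h : y ≤ b * M) : y / b ∈ Set.Icc 0 M :=
  ⟨div_nonneg h0 hp.pos.le, by rw [div_le_iff₀ hp.pos]; linarith⟩

theorem Params.exists_left {y : ℝ} (hy : y ∈ Set.Icc 0 M) : ∃ ω, LeftItin b M ω ∧ ev b ω = y := by
  classical
  have h1 := hp.one_le
  have h2 := hp.le
  obtain ⟨ω, h, h'⟩ := hp.exists_orbit_string (fun y => if b * M < y then 1 else 0)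
    (Set.Icc 0 M) le_rfl (by
      intro y hy
      by_cases hc : b * M < y
      · simp only [hc, if_true]
        exact hp.div_mem_Icc (by simp; linarith) (by have := hy.2; simp; linarith)
      · simp only [hc, if_false]
        exact hp.div_mem_Icc (by simpa using hy.1) (by simpa using hc)) hy
  refine ⟨ω, fun n => ⟨?_, (h' n).2.2⟩, h⟩
  rw [(h' n).1]
  by_cases hc : b * M < ev b (shift^[n] ω) <;> simp [hc]

theorem Params.exists_right {y : ℝ} (hy : y ∈ Set.Ico 0 M) :
    ∃ ω, RightItin b M ω ∧ ev b ω = y := by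
  classical
  have h1 := hp.one_le
  have h2 := hp.le
  obtain ⟨ω, h, h'⟩ := hp.exists_orbit_string (fun y => if b * M ≤ y then 1 else 0)
    (Set.Ico 0 M) Set.Ico_subset_Icc_self (by
      intro y hy
      by_cases hc : b * M ≤ y
      · simp only [hc, if_true]
        refine ⟨(hp.div_mem_Icc (by simp; linarith) (by have := hy.2; simp; linarith)).1, ?_⟩
        rw [div_lt_iff₀ hp.pos]
        have := hy.2
        simp; linarith
      · simp only [hc, if_false]
        rw [not_le] at hc
        refine ⟨(hp.div_mem_Icc (by simpa using hy.1) (by simpa using hc.le)).1, ?_⟩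
        rw [div_lt_iff₀ hp.pos]
        simp; linarith) hy
  refine ⟨ω, fun n => ⟨?_, (h' n).2.2⟩, h⟩
  rw [(h' n).1]
  by_cases hc : b * M ≤ ev b (shift^[n] ω) <;> simp [hc]

/-- A tie takes the digit 0, so points just below have the same leading digit, even below the
switching point itself. The tails are handled by induction, distances scaling by `b`. -/
theorem Params.left_continuity {ω : Str} (hω : LeftItin b M ω) (n : ℕ) :
    ∃ ε > 0, ∀ u, Compat b M u → ev b ω - ε < ev b u → ev b u < ev b ω →
      ∀ k < n, u.digit k = ω.digit k := by
  induction n generalizing ω with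
  | zero => exact ⟨1, one_pos, fun u _ _ _ k hk => absurd hk (by omega)⟩
  | succ n ih =>
    obtain ⟨ε, hε, h⟩ := ih (hω.shift_iterate 1)
    have key : ∀ u, Compat b M u → u.digit 0 = ω.digit 0 → ev b ω - b * ε < ev b u →
        ev b u < ev b ω → ∀ k < n + 1, u.digit k = ω.digit k := by
      intro u hu h0 h1 h2 k hk
      cases k with
      | zero => exact h0
      | succ k =>
        rw [ev_eq hp.pos hp.lt_one ω, ev_eq hp.pos hp.lt_one u, h0] at h1 h2
        refine h (shift u) (hu.shift_iterate 1) ?_ ?_ k (by omega)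
        · exact lt_of_mul_lt_mul_left (a := b)
            (by simp only [Function.iterate_one]; linarith) hp.pos.le
        · exact lt_of_mul_lt_mul_left (a := b)
            (by simp only [Function.iterate_one]; linarith) hp.pos.le
    by_cases h0 : ω.digit 0 = 1
    · have hc := hω.one_iff.1 h0
      refine ⟨min (b * ε) (ev b ω - b * M), lt_min (mul_pos hp.pos hε) (by linarith), ?_⟩
      intro u hu h1 h2
      have h3 := min_le_left (b * ε) (ev b ω - b * M)
      have h4 := min_le_right (b * ε) (ev b ω - b * M)
      refine key u hu ?_ (by linarith) h2
      rw [h0, ← fin_two_ne_zero]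
      intro h5
      have := hu.ev_le_of_zero h5
      linarith
    · rw [fin_two_ne_one] at h0
      refine ⟨b * ε, mul_pos hp.pos hε, fun u hu h1 h2 => key u hu ?_ h1 h2⟩
      rw [h0, ← fin_two_ne_one]
      intro h5
      have := hu.le_ev_of_one h5
      have := hω.zero_iff.1 h0
      linarith

theorem Params.right_continuity {ω : Str} (hω : RightItin b M ω) (n : ℕ) :
    ∃ ε > 0, ∀ u, Compat b M u → ev b ω < ev b u → ev b u < ev b ω + ε →
      ∀ k < n, u.digit k = ω.digit k := by
  induction n generalizing ω with
  | zero => exact ⟨1, one_pos, fun u _ _ _ k hk => absurd hk (by omega)⟩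
  | succ n ih =>
    obtain ⟨ε, hε, h⟩ := ih (hω.shift_iterate 1)
    have key : ∀ u, Compat b M u → u.digit 0 = ω.digit 0 → ev b ω < ev b u →
        ev b u < ev b ω + b * ε → ∀ k < n + 1, u.digit k = ω.digit k := by
      intro u hu h0 h1 h2 k hk
      cases k with
      | zero => exact h0
      | succ k =>
        rw [ev_eq hp.pos hp.lt_one ω, ev_eq hp.pos hp.lt_one u, h0] at h1 h2
        refine h (shift u) (hu.shift_iterate 1) ?_ ?_ k (by omega)
        · exact lt_of_mul_lt_mul_left (a := b)
            (by simp only [Function.iterate_one]; linarith) hp.pos.le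
        · exact lt_of_mul_lt_mul_left (a := b)
            (by simp only [Function.iterate_one]; linarith) hp.pos.le
    by_cases h0 : ω.digit 0 = 1
    · refine ⟨b * ε, mul_pos hp.pos hε, fun u hu h1 h2 => key u hu ?_ h1 h2⟩
      rw [h0, ← fin_two_ne_zero]
      intro h5
      have := hu.ev_le_of_zero h5
      have := hω.one_iff.1 h0
      linarith
    · rw [fin_two_ne_one] at h0
      have hc := hω.zero_iff.1 h0
      refine ⟨min (b * ε) (b * M - ev b ω), lt_min (mul_pos hp.pos hε) (by linarith), ?_⟩
      intro u hu h1 h2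
      have h3 := min_le_left (b * ε) (b * M - ev b ω)
      have h4 := min_le_right (b * ε) (b * M - ev b ω)
      refine key u hu ?_ h1 (by linarith)
      rw [h0, ← fin_two_ne_one]
      intro h5
      have := hu.le_ev_of_one h5
      linarith

theorem Params.exists_left_nhd {ω v : Str} (hω : LeftItin b M ω) (h : v < ω) :
    ∃ ε > 0, ∀ u, Compat b M u → ev b ω - ε < ev b u → ev b u < ev b ω → v < u := by
  obtain ⟨n, hn⟩ := Str.exists_prefix_lt h
  obtain ⟨ε, hε, he⟩ := hp.left_continuity hω n
  exact ⟨ε, hε, fun u hu h1 h2 => hn u (he u hu h1 h2)⟩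

theorem Params.exists_right_nhd {ω v : Str} (hω : RightItin b M ω) (h : ω < v) :
    ∃ ε > 0, ∀ u, Compat b M u → ev b ω < ev b u → ev b u < ev b ω + ε → u < v := by
  obtain ⟨n, hn⟩ := Str.exists_prefix_gt h
  obtain ⟨ε, hε, he⟩ := hp.right_continuity hω n
  exact ⟨ε, hε, fun u hu h1 h2 => hn u (he u hu h1 h2)⟩

end

/-! ### The two itineraries of the switching point. -/

/-- `α` and `β` are the two itineraries of the switching point. -/
structure Critical (b M : ℝ) (α β : Str) : Prop extends Params b M where
  left : LeftItin b M α
  right : RightItin b M β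
  ev_left : ev b α = b * M
  ev_right : ev b β = b * M

theorem Params.exists_critical {b M : ℝ} (hp : Params b M) : ∃ α β, Critical b M α β := by
  have h0 : 0 ≤ b * M := zero_le_one.trans hp.one_le
  obtain ⟨α, h1, h2⟩ := hp.exists_left ⟨h0, hp.switch_lt.le⟩
  obtain ⟨β, h3, h4⟩ := hp.exists_right ⟨h0, hp.switch_lt⟩
  exact ⟨α, β, hp, h1, h3, h2, h4⟩

namespace Critical

variable {b M : ℝ} {α β : Str} (h : Critical b M α β)

include h

theorem α_zero : α.digit 0 = 0 := h.left.zero_iff.2 h.ev_left.le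

theorem β_zero : β.digit 0 = 1 := h.right.one_iff.2 h.ev_right.ge

theorem ev_shift_α : ev b (shift α) = M := by
  have h1 := h.ev_left
  rw [ev_eq_of_zero h.pos h.lt_one h.α_zero] at h1
  exact mul_left_cancel₀ h.pos.ne' h1

theorem α_one : α.digit 1 = 1 :=
  (h.left.shift_iterate 1).one_iff.2 (by
    rw [Function.iterate_one, h.ev_shift_α]; exact h.switch_lt)

theorem β_one : β.digit 1 = 0 :=
  (h.right.shift_iterate 1).zero_iff.2 (by
    have h1 := h.ev_right
    rw [ev_eq_of_one h.pos h.lt_one h.β_zero] at h1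
    have h2 := h.le
    have h3 := h.lt_one
    have h4 := h.pos
    rw [Function.iterate_one]
    -- Here `b * ev b (shift β) = b * M - 1`, and `M ≤ 1 + b * M` bounds this by `b * (b * M) + b -
    -- 1`.
    refine lt_of_mul_lt_mul_left (a := b) ?_ h4.le
    nlinarith [h.switch_lt])

theorem eq_α {ω : Str} (hω : LeftItin b M ω) (he : ev b ω = b * M) : ω = α :=
  h.left_injective hω h.left (he.trans h.ev_left.symm)

theorem eq_β {ω : Str} (hω : RightItin b M ω) (he : ev b ω = b * M) : ω = β :=
  h.right_injective hω h.right (he.trans h.ev_right.symm)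

theorem left_notMem {ω : Str} (hω : LeftItin b M ω) : ω ∉ Set.Ioc α β := by
  rintro ⟨h1, h2⟩
  have h3 := h.left_strictMono h.left.compat hω h1
  have h4 := h.ev_le_ev hω.compat h.right.compat h2
  rw [h.ev_left] at h3
  rw [h.ev_right] at h4
  linarith

theorem right_notMem {ω : Str} (hω : RightItin b M ω) : ω ∉ Set.Ico α β := by
  rintro ⟨h1, h2⟩
  have h3 := h.right_strictMono hω h.right.compat h2
  have h4 := h.ev_le_ev h.left.compat hω.compat h1
  rw [h.ev_left] at h4
  rw [h.ev_right] at h3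
  linarith

theorem admissible : Admissible α β where
  α_zero := h.α_zero
  α_one := h.α_one
  β_zero := h.β_zero
  β_one := h.β_one
  shift_α n := h.left_notMem (h.left.shift_iterate n)
  shift_β n := h.right_notMem (h.right.shift_iterate n)

theorem le_α_of_left {ω : Str} (hω : LeftItin b M ω) (h0 : ω.digit 0 = 0) : ω ≤ α := by
  refine not_lt.1 fun hlt => absurd (h.left_strictMono h.left.compat hω hlt) (not_lt.2 ?_)
  rw [h.ev_left]; exact hω.zero_iff.1 h0

theorem lt_α_of_right {ω : Str} (hω : RightItin b M ω) (h0 : ω.digit 0 = 0) : ω < α :=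
  h.lt_of_ev_lt hω.compat h.left.compat (by rw [h.ev_left]; exact hω.zero_iff.1 h0)

theorem β_lt_of_left {ω : Str} (hω : LeftItin b M ω) (h1 : ω.digit 0 = 1) : β < ω :=
  h.lt_of_ev_lt h.right.compat hω.compat (by rw [h.ev_right]; exact hω.one_iff.1 h1)

theorem β_le_of_right {ω : Str} (hω : RightItin b M ω) (h1 : ω.digit 0 = 1) : β ≤ ω := by
  refine not_lt.1 fun hlt => absurd (h.right_strictMono hω h.right.compat hlt) (not_lt.2 ?_)
  rw [h.ev_right]; exact hω.one_iff.1 h1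

theorem exists_gt_of_lt_α {u : Str} (hu : u < α) :
    ∃ y, 0 ≤ y ∧ y < b * M ∧ ∀ w, Compat b M w → ev b w = y → u < w := by
  obtain ⟨ε, hε, he⟩ := h.exists_left_nhd h.left hu
  rw [h.ev_left] at he
  have := h.one_le
  refine ⟨max 0 (b * M - ε / 2), le_max_left _ _, max_lt (by linarith) (by linarith), ?_⟩
  intro w hw hy
  refine he w hw ?_ ?_
  · rw [hy]; exact lt_of_lt_of_le (by linarith) (le_max_right _ _)
  · rw [hy]; exact max_lt (by linarith) (by linarith)

theorem exists_lt_of_β_lt {u : Str} (hu : β < u) :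
    ∃ y, b * M < y ∧ y < M ∧ ∀ w, Compat b M w → ev b w = y → w < u := by
  obtain ⟨ε, hε, he⟩ := h.exists_right_nhd h.right hu
  rw [h.ev_right] at he
  have := h.switch_lt
  refine ⟨min ((b * M + M) / 2) (b * M + ε / 2), lt_min (by linarith) (by linarith),
    lt_of_le_of_lt (min_le_left _ _) (by linarith), ?_⟩
  intro w hw hy
  refine he w hw ?_ ?_
  · rw [hy]; exact lt_min (by linarith) (by linarith)
  · rw [hy]; exact lt_of_le_of_lt (min_le_right _ _) (by linarith)

theorem isLUB_left : IsLUB {γ | LeftItin b M γ ∧ γ.digit 0 = 0} α :=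
  IsGreatest.isLUB ⟨⟨h.left, h.α_zero⟩, fun _ hγ => h.le_α_of_left hγ.1 hγ.2⟩

/-- The supremum is not attained; left continuity at `α` supplies right itineraries above any
smaller bound. -/
theorem isLUB_right : IsLUB {γ | RightItin b M γ ∧ γ.digit 0 = 0} α := by
  refine ⟨fun γ hγ => (h.lt_α_of_right hγ.1 hγ.2).le, fun u hu => not_lt.1 fun hlt => ?_⟩
  obtain ⟨y, h0, h1, hy⟩ := h.exists_gt_of_lt_α hlt
  obtain ⟨w, hw, hwy⟩ := h.exists_right ⟨h0, h1.trans h.switch_lt⟩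
  exact absurd (hu ⟨hw, hw.zero_iff.2 (by rw [hwy]; exact h1)⟩) (not_le.2 (hy w hw.compat hwy))

theorem isGLB_right : IsGLB {γ | RightItin b M γ ∧ γ.digit 0 = 1} β :=
  IsLeast.isGLB ⟨⟨h.right, h.β_zero⟩, fun _ hγ => h.β_le_of_right hγ.1 hγ.2⟩

theorem isGLB_left : IsGLB {γ | LeftItin b M γ ∧ γ.digit 0 = 1} β := by
  refine ⟨fun γ hγ => (h.β_lt_of_left hγ.1 hγ.2).le, fun u hu => not_lt.1 fun hlt => ?_⟩
  obtain ⟨y, h0, h1, hy⟩ := h.exists_lt_of_β_lt hlt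
  have := h.one_le
  obtain ⟨w, hw, hwy⟩ := h.exists_left ⟨by linarith, h1.le⟩
  exact absurd (hu ⟨hw, hw.one_iff.2 (by rw [hwy]; exact h0)⟩) (not_le.2 (hy w hw.compat hwy))

theorem left_zeroStr : LeftItin b M zeroStr := by
  obtain ⟨ω, hω, h0⟩ := h.exists_left ⟨le_rfl, h.M_pos.le⟩
  obtain rfl | hlt := (zeroStr_le ω).eq_or_lt
  · exact hω
  · obtain ⟨n, -, -, h3⟩ := Str.lt_iff.1 hlt
    have : 0 < ev b ω := by
      unfold ev
      refine (summable_ev h.pos h.lt_one ω).tsum_pos (fun k => by have := h.pos; positivity) n ?_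
      rw [h3]
      have := h.pos
      simp; positivity
    linarith

/-- The tails at the first difference lie on opposite sides of the switching point; equal values
force both onto it. -/
theorem shift_iterate_eq {u v : Str} (hu : LeftItin b M u) (hv : RightItin b M v)
    (he : ev b u = ev b v) (hlt : u < v) :
    ∃ n, (∀ k < n, u.digit k = v.digit k) ∧ shift^[n] u = α ∧ shift^[n] v = β := by
  obtain ⟨n, h1, h2, h3⟩ := Str.lt_iff.1 hlt
  have h4 := (hu.compat n).1 h2
  have h5 := (hv.compat n).2.1 h3
  have h6 := ev_sub_eq h.pos h.lt_one h1
  rw [he, sub_self, eq_comm, mul_eq_zero, or_iff_right (pow_pos h.pos n).ne'] at h6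
  exact ⟨n, h1, h.eq_α (hu.shift_iterate n) (by linarith),
    h.eq_β (hv.shift_iterate n) (by linarith)⟩

/-- Every string lies between the two itineraries of some point. -/
theorem exists_itineraries_around (ω : Str) :
    ∃ u, LeftItin b M u ∧ u ≤ ω ∧
      (ev b u < M → ∃ v, RightItin b M v ∧ ev b v = ev b u ∧ ω ≤ v) := by
  set A : Set ℝ := {y | ∃ w, LeftItin b M w ∧ w ≤ ω ∧ ev b w = y} with hA
  have hAne : A.Nonempty := ⟨_, zeroStr, h.left_zeroStr, zeroStr_le ω, rfl⟩
  have hAbd : BddAbove A := ⟨M, by rintro _ ⟨w, hw, -, rfl⟩; exact hw.compat.ev_le⟩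
  have h0 : 0 ≤ sSup A := le_csSup hAbd ⟨zeroStr, h.left_zeroStr, zeroStr_le ω, by simp⟩
  have h1 : sSup A ≤ M := csSup_le hAne (by rintro _ ⟨w, hw, -, rfl⟩; exact hw.compat.ev_le)
  obtain ⟨u, hu, hue⟩ := h.exists_left ⟨h0, h1⟩
  refine ⟨u, hu, not_lt.1 fun hlt => ?_, fun hlt => ?_⟩
  -- If `ω < u`, itineraries of points just below the supremum would already exceed `ω`.
  · obtain ⟨ε, hε, he⟩ := h.exists_left_nhd hu hlt
    obtain ⟨_, ⟨w, hw, hwω, rfl⟩, hy⟩ := exists_lt_of_lt_csSup hAne (sub_lt_self (sSup A) hε)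
    rcases (le_csSup hAbd ⟨w, hw, hwω, rfl⟩).lt_or_eq with h2 | h2
    · exact absurd hwω (not_le.2 (he w hw.compat (by rwa [hue]) (by rwa [hue])))
    · obtain rfl := h.left_injective hw hu (h2.trans hue.symm)
      exact absurd hwω (not_le.2 hlt)
  · obtain ⟨v, hv, hve⟩ := h.exists_right ⟨ev_nonneg h.pos u, hlt⟩
    refine ⟨v, hv, hve, not_lt.1 fun hlt' => ?_⟩
    -- If `v < ω`, some point above the supremum would still have its itinerary below `ω`.
    obtain ⟨ε, hε, he⟩ := h.exists_right_nhd hv hlt'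
    rw [hve] at he
    have h4 : ev b u < min M (ev b u + ε) := lt_min hlt (by linarith)
    obtain ⟨y, hy1, hy2⟩ := exists_between h4
    obtain ⟨w, hw, hwy⟩ := h.exists_left
      ⟨(ev_nonneg h.pos u).trans hy1.le, (hy2.trans_le (min_le_left _ _)).le⟩
    have h5 := he w hw.compat (by rwa [hwy]) (by rw [hwy]; exact hy2.trans_le (min_le_right _ _))
    have h6 := le_csSup hAbd ⟨w, hw, h5.le, rfl⟩
    rw [← hue, hwy] at h6
    linarith

/-- Squeeze `ω` between the itineraries `u ≤ v` of one point. If they differ, some tail of `ω` lies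
in `[α, β]`; as `(α, β]` is forbidden, this tail is `α` and `ω = u`. At the endpoint `M`, which has
no right itinerary, the condition `0ω ≤ α` replaces `v`. -/
theorem spaceMinusZero_eq : spaceMinusZero α β = {ω | LeftItin b M ω} := by
  ext ω
  constructor
  · rintro ⟨h1, h2⟩
    have h3 : ω ≤ shift α := by
      rw [← consZero_le_consZero]; exact h2.trans_eq (consZero_shift h.α_zero).symm
    obtain ⟨u, hu, huω, hv⟩ := h.exists_itineraries_around ω
    rcases hu.compat.ev_le.lt_or_eq with hM | hM
    · obtain ⟨v, hv, hvu, hωv⟩ := hv hM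
      rcases (huω.trans hωv).eq_or_lt with h4 | h4
      · obtain rfl := le_antisymm huω (hωv.trans_eq h4.symm)
        exact hu
      · obtain ⟨n, h5, h6, h7⟩ := h.shift_iterate_eq hu hv hvu.symm h4
        have h8 := Str.digit_eq_of_mem_Icc huω hωv h5
        have h9 := Str.shift_iterate_le (fun k hk => (h8 k hk).symm) huω
        have h10 := Str.shift_iterate_le (fun k hk => (h8 k hk).trans (h5 k hk)) hωv
        rw [h6] at h9
        rw [h7] at h10
        rcases h9.eq_or_lt with h11 | h11
        · obtain rfl := Str.eq_of_shift_iterate_eq h8 (h11.symm.trans h6.symm)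
          exact hu
        · exact absurd ⟨h11, h10⟩ (h1 n)
    · have h4 : u = shift α :=
        h.left_injective hu (h.left.shift_iterate 1) (hM.trans h.ev_shift_α.symm)
      obtain rfl := le_antisymm huω (h3.trans_eq h4.symm)
      exact hu
  · intro hω
    refine ⟨fun n => h.left_notMem (hω.shift_iterate n), ?_⟩
    rw [← consZero_shift h.α_zero]
    refine consZero_le_consZero.2 (not_lt.1 fun hlt => ?_)
    have := h.left_strictMono (h.left.shift_iterate 1).compat hω hlt
    rw [Function.iterate_one, h.ev_shift_α] at this
    exact absurd hω.compat.ev_le (not_le.2 this)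

theorem spacePlusZero_eq : spacePlusZero α β = {ω | RightItin b M ω} := by
  ext ω
  constructor
  · rintro ⟨h1, h2⟩
    have h3 : ω < shift α := by
      rw [← consZero_lt_consZero]; exact h2.trans_eq (consZero_shift h.α_zero).symm
    obtain ⟨u, hu, huω, hv⟩ := h.exists_itineraries_around ω
    have hM : ev b u < M := by
      refine hu.compat.ev_le.lt_of_ne fun hM => ?_
      have h4 : u = shift α :=
        h.left_injective hu (h.left.shift_iterate 1) (hM.trans h.ev_shift_α.symm)
      exact absurd huω (not_le.2 (h3.trans_eq h4.symm))
    obtain ⟨v, hv, hvu, hωv⟩ := hv hM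
    rcases (huω.trans hωv).eq_or_lt with h4 | h4
    · obtain rfl := le_antisymm hωv (h4.symm.trans_le huω)
      exact hv
    · obtain ⟨n, h5, h6, h7⟩ := h.shift_iterate_eq hu hv hvu.symm h4
      have h8 := Str.digit_eq_of_mem_Icc huω hωv h5
      have h9 := Str.shift_iterate_le (fun k hk => (h8 k hk).symm) huω
      have h8' : ∀ k < n, ω.digit k = v.digit k := fun k hk => (h8 k hk).trans (h5 k hk)
      have h10 := Str.shift_iterate_le h8' hωv
      rw [h6] at h9
      rw [h7] at h10
      rcases h10.eq_or_lt with h11 | h11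
      · obtain rfl := Str.eq_of_shift_iterate_eq h8' (h11.trans h7.symm)
        exact hv
      · exact absurd ⟨h9, h11⟩ (h1 n)
  · intro hω
    refine ⟨fun n => h.right_notMem (hω.shift_iterate n), ?_⟩
    rw [← consZero_shift h.α_zero]
    refine consZero_lt_consZero.2 ?_
    exact h.lt_of_ev_lt hω.compat (h.left.shift_iterate 1).compat
      (by rw [h.ev_shift_α]; exact hω.ev_lt)

end Critical

/-! ### Minimality of the solution `b` by a Hölder estimate. -/

/-- A real function with Hölder exponent larger than `1` on an interval is constant. -/
theorem eq_of_abs_sub_le_rpow {f : ℝ → ℝ} {M C s : ℝ} (hM : 0 < M) (hs : 1 < s)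
    (h : ∀ y z, 0 ≤ y → y < z → z ≤ M → |f z - f y| ≤ C * (z - y) ^ s) : f M = f 0 := by
  -- Cut `[0, M]` into `N + 1` equal steps and add the bounds.
  have hbound : ∀ N : ℕ, |f M - f 0| ≤ C * M ^ s * ((N : ℝ) + 1) ^ (-(s - 1)) := by
    intro N
    have hN : (0 : ℝ) < (N : ℝ) + 1 := by positivity
    set p : ℕ → ℝ := fun k => k * (M / (N + 1)) with hp
    have hsub : ∀ k, p (k + 1) - p k = M / (N + 1) := by
      intro k; simp only [hp]; push_cast; ring
    have hstep : 0 < M / ((N : ℝ) + 1) := by positivity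
    have htel : f M - f 0 = ∑ k ∈ Finset.range (N + 1), (f (p (k + 1)) - f (p k)) := by
      rw [Finset.sum_range_sub (fun k => f (p k))]
      congr 2
      · simp only [hp]; push_cast; field_simp
      · simp [hp]
    rw [htel]
    refine (Finset.abs_sum_le_sum_abs _ _).trans ?_
    have hk : ∀ k ∈ Finset.range (N + 1),
        |f (p (k + 1)) - f (p k)| ≤ C * (M / (N + 1)) ^ s := by
      intro k hk
      rw [← hsub k]
      refine h _ _ (by simp only [hp]; positivity) (by linarith [hsub k]) ?_
      have : ((k + 1 : ℕ) : ℝ) ≤ (N : ℝ) + 1 := by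
        exact_mod_cast Finset.mem_range.1 hk
      calc p (k + 1) ≤ ((N : ℝ) + 1) * (M / (N + 1)) :=
            mul_le_mul_of_nonneg_right this hstep.le
        _ = M := by field_simp
    refine (Finset.sum_le_sum hk).trans (le_of_eq ?_)
    rw [Finset.sum_const, Finset.card_range, nsmul_eq_mul, Real.div_rpow hM.le hN.le,
      neg_sub, Real.rpow_sub hN, Real.rpow_one]
    push_cast
    ring
  have hlim : Filter.Tendsto (fun N : ℕ => C * M ^ s * ((N : ℝ) + 1) ^ (-(s - 1)))
      Filter.atTop (nhds (C * M ^ s * 0)) := by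
    refine Filter.Tendsto.const_mul _ ?_
    exact (tendsto_rpow_neg_atTop (by linarith)).comp
      (Filter.tendsto_atTop_add_const_right _ _ tendsto_natCast_atTop_atTop)
  rw [mul_zero] at hlim
  have := ge_of_tendsto' hlim hbound
  exact sub_eq_zero.1 (abs_nonpos_iff.1 this)

/-- Splitting the difference of two values at the switching point, for any `x` at which `α` and `β`
have equal values. -/
theorem abs_ev_sub_le_split {α β : Str} {x : ℝ} (hx0 : 0 < x) (hx1 : x < 1) (hx : ev x α = ev x β)
    {u v : Str} {n : ℕ} (hn : ∀ k < n, u.digit k = v.digit k) :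
    |ev x v - ev x u| ≤ x ^ n * (|ev x α - ev x (shift^[n] u)| + |ev x (shift^[n] v) - ev x β|) := by
  rw [ev_sub_eq hx0 hx1 hn, abs_mul, abs_of_pos (pow_pos hx0 n)]
  refine mul_le_mul_of_nonneg_left ?_ (pow_pos hx0 n).le
  refine le_trans (le_of_eq ?_) (abs_add_le _ _)
  rw [hx]
  congr 1
  ring

theorem compat_of_left_or_right {b M : ℝ} {u : Str}
    (hu : LeftItin b M u ∨ RightItin b M u) : Compat b M u :=
  hu.elim LeftItin.compat RightItin.compat

namespace Critical

variable {b M : ℝ} {α β : Str} (h : Critical b M α β)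

include h

/-- Gaps between arbitrary itineraries first differing at `n` have no such bound, so the Hölder
estimate is first proved for pairs containing `α` or `β`. -/
theorem exists_gap_lower_bound (m : ℕ) : ∃ δ > 0, ∀ n ≤ m,
    (α.digit n = 1 → δ ≤ ev b (shift^[n] α) - b * M) ∧
      (β.digit n = 0 → δ ≤ b * M - ev b (shift^[n] β)) := by
  induction m with
  | zero =>
    refine ⟨1, one_pos, fun n hn => ?_⟩
    obtain rfl : n = 0 := by omega
    simp [h.α_zero, h.β_zero]
  | succ m ih =>
    obtain ⟨δ, hδ, hd⟩ := ih
    have h1 : ∃ δ > 0, α.digit (m + 1) = 1 → δ ≤ ev b (shift^[m + 1] α) - b * M := by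
      by_cases hα : α.digit (m + 1) = 1
      · exact ⟨_, sub_pos.2 ((h.left _).1.1 hα), fun _ => le_rfl⟩
      · exact ⟨1, one_pos, fun h' => absurd h' hα⟩
    have h2 : ∃ δ > 0, β.digit (m + 1) = 0 → δ ≤ b * M - ev b (shift^[m + 1] β) := by
      by_cases hβ : β.digit (m + 1) = 0
      · refine ⟨_, sub_pos.2 ((h.right.shift_iterate (m + 1)).zero_iff.1 (by simpa using hβ)),
          fun _ => le_rfl⟩
      · exact ⟨1, one_pos, fun h' => absurd h' hβ⟩
    obtain ⟨δ₁, hδ₁, h1⟩ := h1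
    obtain ⟨δ₂, hδ₂, h2⟩ := h2
    refine ⟨min δ (min δ₁ δ₂), lt_min hδ (lt_min hδ₁ hδ₂), fun n hn => ?_⟩
    have l0 := min_le_left δ (min δ₁ δ₂)
    have l1 := (min_le_right δ (min δ₁ δ₂)).trans (min_le_left δ₁ δ₂)
    have l2 := (min_le_right δ (min δ₁ δ₂)).trans (min_le_right δ₁ δ₂)
    rcases Nat.lt_or_ge n (m + 1) with hn' | hn'
    · exact ⟨fun hα => l0.trans ((hd n (by omega)).1 hα),
        fun hβ => l0.trans ((hd n (by omega)).2 hβ)⟩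
    · obtain rfl : n = m + 1 := by omega
      exact ⟨fun hα => l1.trans (h1 hα), fun hβ => l2.trans (h2 hβ)⟩

/-- Since `b ^ s = x`, the common prefix scales both sides alike. By superadditivity of the power
`s` the two pieces merge without loss in `C`; only the additive error doubles, damped by `x ^ n ≤ x
^ m`. -/
theorem hoelder_step {x C θ s E : ℝ} (hx0 : 0 < x) (hx1 : x < 1) (hx : ev x α = ev x β)
    (hC : 0 ≤ C) (hE : 0 ≤ E) (hs : 1 < s) (hbs : b ^ s = x) {m : ℕ} (hθ : 2 * x ^ m ≤ θ)
    {u v : Str} {n : ℕ} (hmn : m ≤ n) (hn : ∀ k < n, u.digit k = v.digit k)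
    (hu0 : ev b (shift^[n] u) ≤ b * M) (hv0 : b * M ≤ ev b (shift^[n] v))
    (hu : |ev x α - ev x (shift^[n] u)| ≤ C * (ev b α - ev b (shift^[n] u)) ^ s + E)
    (hv : |ev x (shift^[n] v) - ev x β| ≤ C * (ev b (shift^[n] v) - ev b β) ^ s + E) :
    |ev x v - ev x u| ≤ C * (ev b v - ev b u) ^ s + θ * E := by
  refine (abs_ev_sub_le_split hx0 hx1 hx hn).trans ?_
  rw [h.ev_left] at hu
  rw [h.ev_right] at hv
  have hsup := Real.add_rpow_le_rpow_add (sub_nonneg.2 hu0) (sub_nonneg.2 hv0) hs.le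
  have hlen : (ev b v - ev b u) ^ s =
      x ^ n * ((b * M - ev b (shift^[n] u)) + (ev b (shift^[n] v) - b * M)) ^ s := by
    rw [ev_sub_eq h.pos h.lt_one hn, Real.mul_rpow (pow_pos h.pos n).le (by linarith),
      ← Real.rpow_natCast, ← Real.rpow_mul h.pos.le, mul_comm (n : ℝ), Real.rpow_mul h.pos.le, hbs,
      Real.rpow_natCast]
    congr 2
    ring
  have hxn := pow_pos hx0 n
  have hxm : x ^ n ≤ x ^ m := pow_le_pow_of_le_one hx0.le hx1.le hmn
  rw [hlen]
  have h1 := mul_le_mul_of_nonneg_left hsup hC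
  have h2 : x ^ n * (2 * E) ≤ θ * E := by nlinarith
  have h3 := mul_le_mul_of_nonneg_left (add_le_add hu hv) hxn.le
  have h4 := mul_le_mul_of_nonneg_left h1 hxn.le
  linarith

theorem le_α {u : Str} (hu : LeftItin b M u ∨ RightItin b M u) (h0 : u.digit 0 = 0) : u ≤ α :=
  hu.elim (fun hu => h.le_α_of_left hu h0) fun hu => (h.lt_α_of_right hu h0).le

theorem β_le {u : Str} (hu : LeftItin b M u ∨ RightItin b M u) (h1 : u.digit 0 = 1) : β ≤ u :=
  hu.elim (fun hu => (h.β_lt_of_left hu h1).le) fun hu => h.β_le_of_right hu h1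

/-- Bootstrapping from the crude bound `D`: each round keeps `C` and multiplies the error by `2 * x
^ m`. For a first difference up to `m` the gap `b ^ m * δ` makes the Hölder term alone dominate `D`;
later ones fall to `hoelder_step`. -/
theorem hoelder_iterate {x C D δ s : ℝ} (hx0 : 0 < x) (hx1 : x < 1) (hx : ev x α = ev x β)
    (hC : 0 ≤ C) (hD : (1 - x)⁻¹ ≤ D) (hs : 1 < s) (hbs : b ^ s = x) {m : ℕ} (hδ0 : 0 < δ)
    (hδ : ∀ n ≤ m, (α.digit n = 1 → δ ≤ ev b (shift^[n] α) - b * M) ∧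
      (β.digit n = 0 → δ ≤ b * M - ev b (shift^[n] β)))
    (hCD : D ≤ C * (b ^ m * δ) ^ s) (N : ℕ) :
    (∀ u, LeftItin b M u ∨ RightItin b M u → u.digit 0 = 0 →
      |ev x α - ev x u| ≤ C * (ev b α - ev b u) ^ s + (2 * x ^ m) ^ N * D) ∧
    (∀ v, LeftItin b M v ∨ RightItin b M v → v.digit 0 = 1 →
      |ev x v - ev x β| ≤ C * (ev b v - ev b β) ^ s + (2 * x ^ m) ^ N * D) := by
  have hD0 : 0 < D := (inv_pos.2 (by linarith)).trans_le hD
  induction N with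
  | zero =>
    have key : ∀ u v, ev b u ≤ ev b v →
        |ev x v - ev x u| ≤ C * (ev b v - ev b u) ^ s + (2 * x ^ m) ^ 0 * D := by
      intro u v huv
      have h1 := abs_ev_sub_le hx0 hx1 u v
      have h2 : 0 ≤ C * (ev b v - ev b u) ^ s :=
        mul_nonneg hC (Real.rpow_nonneg (sub_nonneg.2 huv) s)
      rw [pow_zero, one_mul]
      linarith
    exact ⟨fun u hu h0 => key _ _ (h.ev_le_ev (compat_of_left_or_right hu) h.left.compat (h.le_α hu h0)),
      fun v hv h1 => key _ _ (h.ev_le_ev h.right.compat (compat_of_left_or_right hv) (h.β_le hv h1))⟩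
  | succ N ih =>
    obtain ⟨ihα, ihβ⟩ := ih
    have hE : 0 ≤ (2 * x ^ m) ^ N * D := by positivity
    have key : ∀ u v, LeftItin b M u ∨ RightItin b M u → LeftItin b M v ∨ RightItin b M v →
        u ≤ v → (∀ n ≤ m, u.digit n = 0 → v.digit n = 1 →
          δ ≤ ev b (shift^[n] v) - ev b (shift^[n] u)) →
        |ev x v - ev x u| ≤ C * (ev b v - ev b u) ^ s + (2 * x ^ m) ^ (N + 1) * D := by
      intro u v hu hv huv hgap
      rcases huv.eq_or_lt with rfl | hlt
      · rw [sub_self, sub_self, abs_zero, Real.zero_rpow (by linarith)]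
        positivity
      obtain ⟨n, hn, h0, h1⟩ := Str.lt_iff.1 hlt
      rcases Nat.le_total n m with hnm | hnm
      · have h2 := hgap n hnm h0 h1
        have h3 : b ^ m * δ ≤ ev b v - ev b u := by
          rw [ev_sub_eq h.pos h.lt_one hn]
          exact mul_le_mul (pow_le_pow_of_le_one h.pos.le h.lt_one.le hnm) h2 hδ0.le
            (pow_pos h.pos n).le
        have h4 := Real.rpow_le_rpow (mul_pos (pow_pos h.pos m) hδ0).le h3 (by linarith : 0 ≤ s)
        have h5 := mul_le_mul_of_nonneg_left h4 hC
        have h6 := abs_ev_sub_le hx0 hx1 u v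
        have : 0 ≤ (2 * x ^ m) ^ (N + 1) * D := by positivity
        linarith
      · have hu' := hu.imp (LeftItin.shift_iterate · n) (RightItin.shift_iterate · n)
        have hv' := hv.imp (LeftItin.shift_iterate · n) (RightItin.shift_iterate · n)
        rw [pow_succ', mul_assoc]
        exact h.hoelder_step hx0 hx1 hx hC hE hs hbs le_rfl hnm hn
          ((compat_of_left_or_right hu n).1 h0) ((compat_of_left_or_right hv n).2.1 h1)
          (ihα _ hu' (by simpa using h0)) (ihβ _ hv' (by simpa using h1))
    constructor
    · intro u hu h0
      refine key u α hu (Or.inl h.left) (h.le_α hu h0) fun n hn h1 h2 => ?_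
      have h3 := (hδ n hn).1 h2
      have h4 := (compat_of_left_or_right hu n).1 h1
      linarith
    · intro v hv h0
      refine key β v (Or.inr h.right) hv (h.β_le hv h0) fun n hn h1 h2 => ?_
      have h3 := (hδ n hn).2 h1
      have h4 := (compat_of_left_or_right hv n).2.1 h2
      linarith

theorem ev_ne_of_lt {x : ℝ} (hx0 : 0 < x) (hxb : x < b) : ev x α ≠ ev x β := by
  intro hx
  have hx1 := hxb.trans h.lt_one
  -- With `2 * x ^ m < 1` the errors tend to 0.
  obtain ⟨m, hm⟩ := exists_pow_lt_of_lt_one (by norm_num : (0 : ℝ) < 1 / 2) hx1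
  obtain ⟨δ, hδ0, hδ⟩ := h.exists_gap_lower_bound m
  set s := Real.logb b x with hs'
  have hbs : b ^ s = x := Real.rpow_logb h.pos h.lt_one.ne hx0
  have hs : 1 < s := by
    refine not_le.1 fun hle => ?_
    have := Real.rpow_le_rpow_of_exponent_ge h.pos h.lt_one.le hle
    rw [hbs, Real.rpow_one] at this
    linarith
  set D := (1 - x)⁻¹ with hD
  have hD0 : 0 < D := inv_pos.2 (by linarith)
  have hδs : 0 < (b ^ m * δ) ^ s := Real.rpow_pos_of_pos (mul_pos (pow_pos h.pos m) hδ0) s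
  set C := D / (b ^ m * δ) ^ s with hC
  have hC0 : 0 ≤ C := (div_pos hD0 hδs).le
  have hiter := h.hoelder_iterate hx0 hx1 hx hC0 le_rfl hs hbs hδ0 hδ
    (div_mul_cancel₀ D hδs.ne').ge
  have hlim : ∀ r : ℝ, Filter.Tendsto (fun N : ℕ => r + (2 * x ^ m) ^ N * D) Filter.atTop
      (nhds r) := fun r => by
    have := ((tendsto_pow_atTop_nhds_zero_of_lt_one (by positivity)
      (by linarith : 2 * x ^ m < 1)).mul_const D).const_add r
    simpa using this
  have hα : ∀ u, LeftItin b M u → u.digit 0 = 0 →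
      |ev x α - ev x u| ≤ C * (ev b α - ev b u) ^ s + 0 := fun u hu h0 => by
    rw [add_zero]; exact ge_of_tendsto' (hlim _) fun N => (hiter N).1 u (Or.inl hu) h0
  have hβ : ∀ v, LeftItin b M v → v.digit 0 = 1 →
      |ev x v - ev x β| ≤ C * (ev b v - ev b β) ^ s + 0 := fun v hv h0 => by
    rw [add_zero]; exact ge_of_tendsto' (hlim _) fun N => (hiter N).2 v (Or.inl hv) h0
  have hpair : ∀ u v, LeftItin b M u → LeftItin b M v → u < v →
      |ev x v - ev x u| ≤ C * (ev b v - ev b u) ^ s := by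
    intro u v hu hv huv
    obtain ⟨n, hn, h0, h1⟩ := Str.lt_iff.1 huv
    -- With error `E = 0` the factor `θ` is harmless, so `m = 0` suffices.
    have := h.hoelder_step hx0 hx1 hx hC0 le_rfl hs hbs (m := 0) le_rfl (Nat.zero_le n) hn
      ((hu.compat n).1 h0) ((hv.compat n).2.1 h1) (hα _ (hu.shift_iterate n) (by simpa using h0))
      (hβ _ (hv.shift_iterate n) (by simpa using h1))
    simpa using this
  choose! t ht hte using fun y (hy : y ∈ Set.Icc 0 M) => h.exists_left hy
  have hconst := eq_of_abs_sub_le_rpow (f := fun y => ev x (t y)) h.M_pos hs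
    (C := C) (by
      intro y z h0 hyz hzM
      have hy : y ∈ Set.Icc 0 M := ⟨h0, by linarith⟩
      have hz : z ∈ Set.Icc 0 M := ⟨by linarith, hzM⟩
      have := hpair (t y) (t z) (ht y hy) (ht z hz)
        (h.lt_of_ev_lt (ht y hy).compat (ht z hz).compat (by rwa [hte y hy, hte z hz]))
      rwa [hte y hy, hte z hz] at this)
  have hz : (0 : ℝ) ∈ Set.Icc 0 M := ⟨le_rfl, h.M_pos.le⟩
  have hM : M ∈ Set.Icc 0 M := ⟨h.M_pos.le, le_rfl⟩
  rw [h.left_injective (ht 0 hz) h.left_zeroStr (by rw [hte 0 hz, ev_zeroStr]),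
    h.left_injective (ht M hM) (h.left.shift_iterate 1)
      (by rw [hte M hM]; exact h.ev_shift_α.symm), ev_zeroStr, Function.iterate_one,
    ev_eq_of_one hx0 hx1 h.α_one] at hconst
  have := mul_nonneg hx0.le (ev_nonneg hx0 (shift (shift α)))
  linarith

theorem isLeast_solutions : IsLeast (solutions α β) b := by
  refine ⟨⟨⟨h.half_le, h.lt_one⟩, h.ev_left.trans h.ev_right.symm⟩, fun x hx => ?_⟩
  refine not_lt.1 fun hlt => h.ev_ne_of_lt (by linarith [hx.1.1]) hlt hx.2

theorem leastSolution_eq : leastSolution α β = b := h.isLeast_solutions.csInf_eq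

end Critical

/-! ### Exponential growth of the number of prefixes. -/

theorem ncard_initialSegments_le (Γ : Set Str) (n : ℕ) : (initialSegments Γ n).ncard ≤ 2 ^ n := by
  refine (Set.ncard_le_card _).trans ?_
  simp

namespace Critical

variable {b M : ℝ} {α β : Str} (h : Critical b M α β)

include h

theorem le_ncard_initialSegments (n : ℕ) :
    M * (1 - b) / 2 * (b⁻¹) ^ n ≤
      ((initialSegments (spaceMinus α β ∪ spacePlus α β) n).ncard : ℝ) := by
  have h1b : 0 < 1 - b := by linarith [h.lt_one]
  have hbn := pow_pos h.pos n
  -- Twice the largest possible distance between the values of two strings with a common prefix of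
  -- length `n`.
  obtain ⟨r, hr⟩ : ∃ r, r = 2 * b ^ n * (1 - b)⁻¹ := ⟨_, rfl⟩
  have hr0 : 0 < r := by rw [hr]; positivity
  set J := ⌊M / r⌋₊ with hJ
  have hJM : ∀ j ≤ J, (j : ℝ) * r ∈ Set.Icc 0 M := fun j hj => by
    refine ⟨by positivity, ?_⟩
    rw [← le_div_iff₀ hr0]
    exact (Nat.cast_le.2 hj).trans (Nat.floor_le (by have := h.M_pos; positivity))
  choose! t ht hte using fun y (hy : y ∈ Set.Icc 0 M) => h.exists_left hy
  let F : ℕ → Fin n → Fin 2 := fun j i => (t (j * r)).digit i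
  have hinj : Set.InjOn F (Finset.range (J + 1)) := by
    intro j hj k hk hjk
    by_contra hne
    have hj' := hJM j (by simpa [Nat.lt_succ_iff] using hj)
    have hk' := hJM k (by simpa [Nat.lt_succ_iff] using hk)
    have hpre : ∀ i < n, (t (j * r)).digit i = (t (k * r)).digit i := fun i hi =>
      congrFun hjk ⟨i, hi⟩
    have h1 := congrArg abs (ev_sub_eq h.pos h.lt_one hpre)
    rw [hte _ hj', hte _ hk', ← sub_mul, abs_mul, abs_mul, abs_of_pos hr0, abs_of_pos hbn] at h1
    have h2 := mul_le_mul_of_nonneg_left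
      (abs_ev_sub_le h.pos h.lt_one (shift^[n] (t (j * r))) (shift^[n] (t (k * r)))) hbn.le
    have h3 : (1 : ℝ) ≤ |(k : ℝ) - j| := by
      have : (1 : ℤ) ≤ |(k : ℤ) - j| := Int.one_le_abs (by omega)
      exact_mod_cast this
    have h4 : r ≤ |(k : ℝ) - j| * r := le_mul_of_one_le_left hr0.le h3
    have h5 : 0 < b ^ n * (1 - b)⁻¹ := by positivity
    linarith
  have hsub : F '' (Finset.range (J + 1)) ⊆
      initialSegments (spaceMinus α β ∪ spacePlus α β) n := by
    rintro _ ⟨j, hj, rfl⟩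
    have hj' := hJM j (by simpa [Nat.lt_succ_iff] using hj)
    exact ⟨t (j * r), Or.inl fun m => h.left_notMem ((ht _ hj').shift_iterate m), rfl⟩
  have hcard := Set.ncard_le_ncard hsub (Set.toFinite _)
  rw [hinj.ncard_image, Set.ncard_coe_finset, Finset.card_range] at hcard
  have h6 : M / r ≤ ((J + 1 : ℕ) : ℝ) := by push_cast; exact (Nat.lt_floor_add_one _).le
  refine le_trans (le_of_eq ?_) (h6.trans (Nat.cast_le.2 hcard))
  rw [hr, inv_pow]
  field_simp

theorem not_null : ¬ Null α β := by
  intro hnull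
  set a : ℕ → ℝ := fun n =>
    Real.log ((initialSegments (spaceMinus α β ∪ spacePlus α β) n).ncard : ℝ) with ha
  have h1b : 0 < 1 - b := by linarith [h.lt_one]
  have hMp := h.M_pos
  have hbp := h.pos
  set c := M * (1 - b) / 2 with hc
  have hc0 : 0 < c := by positivity
  have hL : 0 < Real.log b⁻¹ := Real.log_pos ((one_lt_inv₀ h.pos).2 h.lt_one)
  have hlow : ∀ n : ℕ, Real.log c + n * Real.log b⁻¹ ≤ a n := fun n => by
    rw [← Real.log_pow, ← Real.log_mul hc0.ne' (by positivity)]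
    exact Real.log_le_log (by positivity) (h.le_ncard_initialSegments n)
  have hpos : ∀ n : ℕ, (0 : ℝ) < ((initialSegments (spaceMinus α β ∪ spacePlus α β) n).ncard : ℝ) :=
    fun n => lt_of_lt_of_le (by positivity) (h.le_ncard_initialSegments n)
  have hbdd : Filter.IsBoundedUnder (· ≤ ·) Filter.atTop fun n : ℕ => 1 / (n : ℝ) * a n := by
    refine Filter.isBoundedUnder_of ⟨Real.log 2, fun n => ?_⟩
    rcases Nat.eq_zero_or_pos n with rfl | hn
    · simpa using Real.log_nonneg one_le_two
    have hn' : (0 : ℝ) < n := by exact_mod_cast hn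
    rw [one_div, inv_mul_le_iff₀ hn', ← Real.log_pow]
    exact Real.log_le_log (hpos n) (by exact_mod_cast ncard_initialSegments_le _ n)
  have hlim : Filter.limsup (fun n : ℕ => 1 / (n : ℝ) * a n) Filter.atTop
      < Real.log b⁻¹ / 2 := lt_of_eq_of_lt hnull (by positivity)
  have hev := Filter.eventually_lt_of_limsup_lt hlim hbdd
  -- For such `n` the constant `log c` costs at most half of the linear growth.
  obtain ⟨n, hn, hn0, hnc⟩ := (hev.and ((Filter.eventually_gt_atTop 0).and
    ((tendsto_natCast_atTop_atTop (R := ℝ)).eventually_ge_atTop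
      (-Real.log c / (Real.log b⁻¹ / 2))))).exists
  have hn' : (0 : ℝ) < n := by exact_mod_cast hn0
  rw [one_div, inv_mul_lt_iff₀ hn'] at hn
  rw [div_le_iff₀ (by positivity)] at hnc
  have := hlow n
  linarith

end Critical

/-! ### Decimals and shift invariance. -/

theorem place_consZero (ω : Str) (N : ℤ) : place (consZero ω) (N + 1) = place ω N := by
  ext n : 2
  simp only [place]
  rcases lt_trichotomy n (N + 1) with hn | hn | hn
  · rw [if_pos hn.le, if_pos (by omega), show (N + 1 - n).toNat = (N - n).toNat + 1 by omega,
      digit_consZero_succ]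
  · subst hn
    simp
  · rw [if_neg (by omega), if_neg (by omega)]

theorem value_place {B : ℝ} (hB : B ≠ 0) (ω : Str) (N : ℤ) :
    (place ω N).value B = B ^ N * ev B⁻¹ ω := by
  have hinj : Function.Injective fun k : ℕ => N - (k : ℤ) := fun j k hjk => by
    simpa using hjk
  have hsupp : Function.support (fun n : ℤ => (((place ω N).digit n : ℕ) : ℝ) * B ^ n) ⊆
      Set.range fun k : ℕ => N - (k : ℤ) := by
    intro n hn
    by_cases hnN : n ≤ N
    · exact ⟨(N - n).toNat, by simp only []; omega⟩
    · exact absurd (by simp [place, hnN]) hn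
  rw [Decimal.value, ← hinj.tsum_eq hsupp, ev, ← tsum_mul_left]
  congr 1
  ext k
  simp only [place, sub_le_self_iff, Int.natCast_nonneg, if_true, sub_sub_cancel, Int.toNat_natCast]
  rw [zpow_sub₀ hB, zpow_natCast, inv_pow]
  ring

section hat

variable {Γ : Set Decimal} (hΓ : ShiftInvariant Γ)

include hΓ

theorem ShiftInvariant.dot_hat : dot (hat Γ) = Γ := by simpa using hΓ 0

theorem ShiftInvariant.place_mem {ω : Str} (hω : ω ∈ hat Γ) (N : ℤ) : place ω N ∈ Γ := by
  rw [← hΓ.dot_hat]; exact ⟨ω, hω, N, rfl⟩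

theorem ShiftInvariant.shift_mem {ω : Str} (hω : ω ∈ hat Γ) : shift ω ∈ hat Γ := by
  refine ⟨0, by norm_num, ?_⟩
  rw [← hΓ 1]
  exact ⟨shift ω, ⟨ω, hω, rfl⟩, 0, rfl⟩

theorem ShiftInvariant.shift_iterate_mem {ω : Str} (hω : ω ∈ hat Γ) (n : ℕ) :
    shift^[n] ω ∈ hat Γ := by
  induction n with
  | zero => exact hω
  | succ n ih => rw [Function.iterate_succ_apply']; exact hΓ.shift_mem ih

theorem ShiftInvariant.consZero_mem {ω : Str} (hω : ω ∈ hat Γ) : consZero ω ∈ hat Γ :=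
  ⟨0, by norm_num, by
    rw [show (0 : ℤ) = -1 + 1 by norm_num, place_consZero]; exact hΓ.place_mem hω _⟩

end hat

/-! ### The strings of a radix system are itineraries. -/

namespace RadixTriple.IsBinaryRadixSystem

variable {T : RadixTriple} (hT : T.IsBinaryRadixSystem)

include hT

theorem inv_base_pos : 0 < T.base⁻¹ := inv_pos.2 (zero_lt_one.trans hT.one_lt_base)

theorem inv_base_lt_one : T.base⁻¹ < 1 := inv_lt_one_of_one_lt₀ hT.one_lt_base

theorem base_ne_zero : T.base ≠ 0 := (zero_lt_one.trans hT.one_lt_base).ne'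

theorem ev_strictMono {u v : Str} (hu : u ∈ hat T.space) (hv : v ∈ hat T.space) (huv : u < v) :
    ev T.base⁻¹ u < ev T.base⁻¹ v := by
  have h := hT.strictlyIncreasing ⟨_, hT.shiftInvariant.place_mem hu 0⟩
    ⟨_, hT.shiftInvariant.place_mem hv 0⟩ ⟨u, v, 0, by norm_num, rfl, rfl, huv⟩
  rw [← NNReal.coe_lt_coe, hT.radixMap_eq, hT.radixMap_eq, value_place hT.base_ne_zero,
    value_place hT.base_ne_zero] at h
  simpa using h

theorem exists_ev_eq {x : ℝ} (hx : 0 ≤ x) :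
    ∃ ω ∈ hat T.space, ∃ N : ℕ, x = T.base ^ N * ev T.base⁻¹ ω := by
  obtain ⟨⟨d, hd⟩, he⟩ := hT.bijective.2 ⟨x, hx⟩
  have hval : d.value T.base = x := by
    have := hT.radixMap_eq ⟨d, hd⟩
    rw [he] at this
    exact this.symm
  rw [← hT.shiftInvariant.dot_hat] at hd
  obtain ⟨ω, hω, N, rfl⟩ := hd
  rw [value_place hT.base_ne_zero] at hval
  rcases le_total 0 N with hN | hN
  · lift N to ℕ using hN
    exact ⟨ω, hω, N, by rw [← hval, zpow_natCast]⟩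
  -- Negative powers of the base are absorbed by prefixed zeros.
  · obtain ⟨n, rfl⟩ := Int.exists_eq_neg_ofNat hN
    clear hN
    rw [zpow_neg, zpow_natCast, ← inv_pow] at hval
    subst hval
    clear he hx hd
    induction n generalizing ω with
    | zero => exact ⟨ω, hω, 0, by simp⟩
    | succ n ih =>
      obtain ⟨u, hu, N, hN⟩ := ih (consZero ω) (hT.shiftInvariant.consZero_mem hω)
      refine ⟨u, hu, N, ?_⟩
      rw [← hN, ev_consZero hT.inv_base_pos hT.inv_base_lt_one]
      ring

theorem iterate_consZero_mem {v : Str} (hv : v ∈ hat T.space) (n : ℕ) :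
    ∃ w ∈ hat T.space, ev T.base⁻¹ w = T.base⁻¹ ^ n * ev T.base⁻¹ v ∧ (0 < n → w.digit 0 = 0) := by
  induction n with
  | zero => exact ⟨v, hv, by simp, fun h => absurd h (lt_irrefl _)⟩
  | succ n ih =>
    obtain ⟨w, hw, hw', -⟩ := ih
    refine ⟨consZero w, hT.shiftInvariant.consZero_mem hw, ?_, fun _ => rfl⟩
    rw [ev_consZero hT.inv_base_pos hT.inv_base_lt_one, hw']
    ring

/-- The values of the strings of a radix system form a lower set of non-negative numbers. -/
theorem exists_of_lt {v : Str} (hv : v ∈ hat T.space) {x : ℝ} (hx : 0 ≤ x)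
    (hxv : x < ev T.base⁻¹ v) : ∃ w ∈ hat T.space, ev T.base⁻¹ w = x := by
  obtain ⟨ω, hω, N, hN⟩ := hT.exists_ev_eq hx
  have hB := zero_lt_one.trans hT.one_lt_base
  clear hx
  induction N generalizing ω with
  | zero => exact ⟨ω, hω, by simpa using hN.symm⟩
  | succ N ih =>
    by_cases h0 : ω.digit 0 = 0
    · refine ih _ (hT.shiftInvariant.shift_mem hω) ?_
      rw [hN, ev_eq_of_zero hT.inv_base_pos hT.inv_base_lt_one h0, pow_succ, mul_assoc,
        mul_inv_cancel_left₀ hT.base_ne_zero]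
    -- A leading 1 is impossible: `v` behind `N + 1` zeros is a smaller string than `ω`, which would
    -- give `ev v < x`.
    · rw [fin_two_ne_zero] at h0
      obtain ⟨w, hw, hwv, hw0⟩ := hT.iterate_consZero_mem hv (N + 1)
      have h1 := hT.ev_strictMono hw hω (Str.lt_of_digit_zero (hw0 (by omega)) h0)
      rw [hwv, inv_pow, inv_mul_lt_iff₀ (by positivity), ← hN] at h1
      exact absurd hxv h1.not_gt

/-- The least upper bound of the values of the strings of a radix system. -/
theorem exists_isLUB : ∃ M, IsLUB (ev T.base⁻¹ '' hat T.space) M := by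
  obtain ⟨ω, hω, -⟩ := hT.exists_ev_eq le_rfl
  exact Real.exists_isLUB ⟨_, ω, hω, rfl⟩
    ⟨(1 - T.base⁻¹)⁻¹, by
      rintro _ ⟨u, -, rfl⟩; exact ev_le hT.inv_base_pos hT.inv_base_lt_one u⟩

variable {M : ℝ} (hM : IsLUB (ev T.base⁻¹ '' hat T.space) M)

include hM

theorem exists_of_lt_isLUB {x : ℝ} (hx : 0 ≤ x) (hxM : x < M) :
    ∃ w ∈ hat T.space, ev T.base⁻¹ w = x := by
  obtain ⟨_, ⟨v, hv, rfl⟩, h, -⟩ := hM.exists_between hxM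
  exact hT.exists_of_lt hv hx h

theorem ev_le_of_digit_zero {ω : Str} (hω : ω ∈ hat T.space) (h0 : ω.digit 0 = 0) :
    ev T.base⁻¹ ω ≤ T.base⁻¹ * M := by
  rw [ev_eq_of_zero hT.inv_base_pos hT.inv_base_lt_one h0]
  exact mul_le_mul_of_nonneg_left (hM.1 (Set.mem_image_of_mem _ <| hT.shiftInvariant.shift_mem hω))
    hT.inv_base_pos.le

/-- Strings `0w` lie below `ω`, and their values come arbitrarily close to `b * M`. -/
theorem le_ev_of_digit_one {ω : Str} (hω : ω ∈ hat T.space) (h1 : ω.digit 0 = 1) :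
    T.base⁻¹ * M ≤ ev T.base⁻¹ ω := by
  refine le_of_forall_lt fun y hy => ?_
  have hb := hT.inv_base_pos
  have hy' : max 0 y / T.base⁻¹ < M ∨ M = 0 := by
    rcases (ev_nonneg hb ω |>.trans (hM.1 (Set.mem_image_of_mem _ hω))).lt_or_eq with hM0 | hM0
    · left
      rw [div_lt_iff₀ hb, mul_comm]
      exact max_lt (mul_pos hb hM0) hy
    · exact Or.inr hM0.symm
  rcases hy' with hy' | hM0
  · obtain ⟨w, hw, hwe⟩ := hT.exists_of_lt_isLUB hM
      (div_nonneg (le_max_left 0 y) hb.le) hy'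
    have h2 := hT.ev_strictMono (hT.shiftInvariant.consZero_mem hw) hω
      (Str.lt_of_digit_zero (digit_consZero_zero w) h1)
    rw [ev_consZero hb hT.inv_base_lt_one, hwe, mul_div_cancel₀ _ hb.ne'] at h2
    exact (le_max_right 0 y).trans_lt h2
  · rw [hM0, mul_zero] at hy
    exact hy.trans_le (ev_nonneg hb ω)

theorem params : Params T.base⁻¹ M := by
  have hb := hT.inv_base_pos
  have hb1 := hT.inv_base_lt_one
  have hM0 : 0 < M := by
    obtain ⟨ω, hω, N, hN⟩ := hT.exists_ev_eq zero_le_one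
    refine lt_of_lt_of_le ?_ (hM.1 (Set.mem_image_of_mem _ hω))
    refine (ev_nonneg hb ω).lt_of_ne fun h => ?_
    rw [← h, mul_zero] at hN
    exact one_ne_zero hN
  refine ⟨hb, hb1, ?_, ?_⟩
  · refine le_of_forall_gt fun y hy => ?_
    have hbM : T.base⁻¹ * M < M := mul_lt_of_lt_one_left hM0 hb1
    -- A string with value `z` strictly between `b * M` and `M` must begin with 1, so `1 ≤ z`.
    obtain ⟨z, hz1, hz2⟩ := exists_between (lt_min hy hbM)
    obtain ⟨w, hw, hwe⟩ := hT.exists_of_lt_isLUB hM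
      ((mul_pos hb hM0).le.trans hz1.le) (hz2.trans_le (min_le_right _ _))
    have h1 : w.digit 0 = 1 := by
      rw [← fin_two_ne_zero]
      intro h0
      have := hT.ev_le_of_digit_zero hM hw h0
      rw [hwe] at this
      exact absurd this hz1.not_ge
    rw [ev_eq_of_one hb hb1 h1] at hwe
    have := mul_nonneg hb.le (ev_nonneg hb (shift w))
    linarith [hz2.trans_le (min_le_left _ _)]
  · refine hM.2 ?_
    rintro _ ⟨ω, hω, rfl⟩
    rw [ev_eq hb hb1]
    exact add_le_add (digit_cast_le_one _) (mul_le_mul_of_nonneg_left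
      (hM.1 (Set.mem_image_of_mem _ <| hT.shiftInvariant.shift_mem hω)) hb.le)

/-- If `m` attains `M`, then `0m` has value `b * M` and precedes every string beginning with 1; this
settles the tie. Conversely, an itinerary is determined by its value, and that value is attained in
Γ̂. -/
theorem hat_eq_left (hmem : M ∈ ev T.base⁻¹ '' hat T.space) :
    hat T.space = {ω | LeftItin T.base⁻¹ M ω} := by
  obtain ⟨m, hm, hmM⟩ := hmem
  have hp := hT.params hM
  have hsub : ∀ ω ∈ hat T.space, LeftItin T.base⁻¹ M ω := by
    intro ω hω n
    have hn := hT.shiftInvariant.shift_iterate_mem hω n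
    refine ⟨⟨fun h1 => ?_, fun hlt => ?_⟩, hM.1 (Set.mem_image_of_mem _ hn)⟩
    · have := hT.ev_strictMono (hT.shiftInvariant.consZero_mem hm) hn
        (Str.lt_of_digit_zero (digit_consZero_zero m) (by simpa using h1))
      rwa [ev_consZero hp.pos hp.lt_one, hmM] at this
    · rw [← fin_two_ne_zero]
      exact fun h0 => absurd (hT.ev_le_of_digit_zero hM hn (by simpa using h0)) hlt.not_ge
  refine Set.Subset.antisymm hsub fun ω hω => ?_
  rcases hω.compat.ev_le.lt_or_eq with hlt | heq
  · obtain ⟨w, hw, hwe⟩ := hT.exists_of_lt_isLUB hM (ev_nonneg hp.pos ω) hlt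
    rwa [← hp.left_injective (hsub w hw) hω hwe]
  · rwa [← hp.left_injective (hsub m hm) hω (hmM.trans heq.symm)]

/-- If `M` is not attained, a leading 0 forces a value strictly below `b * M`, so the tie goes to 1.
-/
theorem hat_eq_right (hmem : M ∉ ev T.base⁻¹ '' hat T.space) :
    hat T.space = {ω | RightItin T.base⁻¹ M ω} := by
  have hp := hT.params hM
  have hlt : ∀ ω ∈ hat T.space, ev T.base⁻¹ ω < M := fun ω hω =>
    (hM.1 (Set.mem_image_of_mem _ hω)).lt_of_ne fun h => hmem ⟨ω, hω, h⟩
  have hsub : ∀ ω ∈ hat T.space, RightItin T.base⁻¹ M ω := by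
    intro ω hω n
    have hn := hT.shiftInvariant.shift_iterate_mem hω n
    refine ⟨⟨fun h1 => hT.le_ev_of_digit_one hM hn (by simpa using h1), fun hle => ?_⟩, hlt _ hn⟩
    rw [← fin_two_ne_zero]
    intro h0
    have h0' : (shift^[n] ω).digit 0 = 0 := by simpa using h0
    rw [ev_eq_of_zero hp.pos hp.lt_one h0'] at hle
    exact absurd (le_of_mul_le_mul_left hle hp.pos)
      (hlt _ (hT.shiftInvariant.shift_mem hn)).not_ge
  refine Set.Subset.antisymm hsub fun ω hω => ?_
  obtain ⟨w, hw, hwe⟩ := hT.exists_of_lt_isLUB hM (ev_nonneg hp.pos ω) hω.ev_lt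
  rwa [← hp.right_injective (hsub w hw) hω hwe]

end RadixTriple.IsBinaryRadixSystem

theorem RadixTriple.IsBinaryRadixSystem.eq_mk {T : RadixTriple} (hT : T.IsBinaryRadixSystem)
    {Γ : Set Decimal} {B : ℝ} (hΓ : Γ = T.space) (hB : B = T.base) :
    (⟨Γ, fun d => ((d : Decimal).value B).toNNReal, B⟩ : RadixTriple) = T := by
  obtain ⟨Γ', π, B'⟩ := T
  obtain rfl : Γ = Γ' := hΓ
  obtain rfl : B = B' := hB
  congr 1
  ext d
  have := hT.radixMap_eq d
  rw [← this, Real.toNNReal_coe]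

end BinaryRadix

theorem mainTheorem1 (T : BinaryRadix.RadixTriple) (hT : T.IsBinaryRadixSystem) :
    ∃ α β : BinaryRadix.Str,
      IsLUB {γ : BinaryRadix.Str | γ ∈ BinaryRadix.hat T.space ∧ γ.digit 0 = 0} α ∧
      IsGLB {γ : BinaryRadix.Str | γ ∈ BinaryRadix.hat T.space ∧ γ.digit 0 = 1} β ∧
      BinaryRadix.Admissible α β ∧
      ¬ BinaryRadix.Null α β ∧
      IsLeast (BinaryRadix.solutions α β) (BinaryRadix.leastSolution α β) ∧
      (BinaryRadix.RMinus α β = T ∨ BinaryRadix.RPlus α β = T) := by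
  obtain ⟨M, hM⟩ := hT.exists_isLUB
  obtain ⟨α, β, h⟩ := (hT.params hM).exists_critical
  have hbase : BinaryRadix.baseOf α β = T.base := by
    rw [BinaryRadix.baseOf, h.leastSolution_eq, one_div, inv_inv]
  have hleast : IsLeast (BinaryRadix.solutions α β) (BinaryRadix.leastSolution α β) := by
    rw [h.leastSolution_eq]; exact h.isLeast_solutions
  by_cases hmem : M ∈ BinaryRadix.ev T.base⁻¹ '' BinaryRadix.hat T.space
  · have hW := hT.hat_eq_left hM hmem
    refine ⟨α, β, ?_, ?_, h.admissible, h.not_null, hleast, Or.inl (hT.eq_mk ?_ hbase)⟩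
    · rw [hW]; exact h.isLUB_left
    · rw [hW]; exact h.isGLB_left
    · rw [h.spaceMinusZero_eq, ← hW, hT.shiftInvariant.dot_hat]
  · have hW := hT.hat_eq_right hM hmem
    refine ⟨α, β, ?_, ?_, h.admissible, h.not_null, hleast, Or.inr (hT.eq_mk ?_ hbase)⟩
    · rw [hW]; exact h.isLUB_right
    · rw [hW]; exact h.isGLB_right
    · rw [h.spacePlusZero_eq, ← hW, hT.shiftInvariant.dot_hat]
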